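/- Let $K$ be a linearly ordered set and let $\{(\mathcal A_{k,\ell},\mathcal A_{k,r})\}_{k\in K}$ be pairs of (not necessarily unital) subalgebras of a complex algebra $\mathcal A$ with a linear functional $\varphi:\mathcal A\to\mathbb C$, extended by $\tilde\varphi(\lambda 1+a)=\lambda+\varphi(a)$ to the unitization $\widetilde{\mathcal A}=\mathbb C1\oplus\mathcal A$. Write $\sqcup$ for the free product without identification of units, so that the unitization of $\mathcal B_1\sqcup \mathcal B_2$ is the unital free product $\widetilde{\mathcal B_1}*\widetilde{\mathcal B_2}$. For $\chi:\{1,\dots,n\}\to\{\ell,r\}$ let $\prec_\chi$ be the total order on $\{1,\dots,n\}$ that lists first $\chi^{-1}(\ell)$ increasingly and then $\chi^{-1}(r)$ decreasingly. For $\omega:\{1,\dots,n\}\to K$ let $\pi_{\chi,\omega}$ be the partition of $\{1,\dots,n\}$ into the maximal $\prec_\chi$-intervals on which $\omega$ is constant, with blocks $V_1,\dots,V_m$ listed in the order $\prec_\chi$; $\omega(V)$ is the value of $\omega$ on a block $V$. For $V=\{v_1<\dots<v_s\}$ put $a_V=a_{v_1}\cdots a_{v_s}$, with $\varphi(a_\emptyset)=1$.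 A family of pairs $(\mathcal B_{k,\ell},\mathcal B_{k,r})$ of unital subalgebras of a unital algebra is *conditionally bi-free* with respect to two unital functionals $(\Phi,\Psi)$ if, for all $n\ge1$, $\chi$, $\omega$ and $a_j\in\mathcal B_{\omega(j),\chi(j)}$ with $\Psi(a_V)=0$ for all $V\in\pi_{\chi,\omega}$, one has $\Psi(a_1\cdots a_n)=0$ and $\Phi(a_1\cdots a_n)=\prod_{V\in\pi_{\chi,\omega}}\Phi(a_V)$. Given functionals $\varphi_k$ on $\mathcal A_{k,\ell}\sqcup\mathcal A_{k,r}$ ($k=1,2$), let $(\Phi,\Psi)$ be the pair of unital functionals on the unital free product of the $\widetilde{\mathcal A_{k,\ell}\sqcup\mathcal A_{k,r}}$ that restricts to $(\tilde\varphi_1,\delta_1)$ and $(\tilde\varphi_2,\tilde\varphi_2)$, where $\delta_1(\lambda1+a)=\lambda$, and for which the pairs $(\widetilde{\mathcal A_{k,\ell}},\widetilde{\mathcal A_{k,r}})$ are conditionally bi-free; the *bi-monotonic product* of $\varphi_1$ and $\varphi_2$ is the restriction of $\Phi$ to $(\mathcal A_{1,\ell}\sqcup\mathcal A_{1,r})\sqcup(\mathcal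 A_{2,\ell}\sqcup\mathcal A_{2,r})$. The family is *bi-monotonically independent (type I)* if, for all $k_0<\dots<k_p$ in $K$, the joint distribution of the pairs with indices $k_0,\dots,k_p$ with respect to $\varphi$ is the iterated bi-monotonic product, in this order, of the distributions of the single pairs. Suppose that $\{(\mathcal A_{k,\ell},\mathcal A_{k,r})\}_{k\in K}$ is bi-monotonically independent (type I) with respect to $\varphi$. Then: 1. Let $n\ge1$, $\chi:\{1,\dots,n\}\to\{\ell,r\}$, $\omega:\{1,\dots,n\}\to K$ and $a_j\in\mathcal A_{\omega(j),\chi(j)}$, and let $V_1,\dots,V_m$ be the ordered blocks of $\pi_{\chi,\omega}$. If $k$ is such that $\omega(V_{k-1})<\omega(V_k)>\omega(V_{k+1})$ (the first inequality is omitted if $k=1$ and the second if $k=m$), then $$\varphi(a_1\cdots a_n)=\varphi(a_{V_k})\,\varphi(a_W),\qquad W=\{1,\dots,n\}\setminus V_k .$$ 2. The left algebras $\{\mathcal A_{k,\ell}\}_{k\in K}$ are monotonically independent, and so are the right algebras $\{\mathcal A_{k,r}\}_{k\in K}$. Here $\{\mathcal B_k\}_{k\in K}$ is monotonically independent if $\varphi(a_1\cdots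 a_n)=\varphi(a_p)\,\varphi(a_1\cdots a_{p-1}a_{p+1}\cdots a_n)$ whenever $a_j\in\mathcal B_{k_j}$ and $k_{p-1}<k_p>k_{p+1}$ (one inequality being omitted if $p=1$ or $p=n$). 3. If $k\ne j$, then $\mathcal A_{k,\ell}$ and $\mathcal A_{j,r}$ are classically independent: for $b\in\mathcal A_{k,\ell}$ and $c\in\mathcal A_{j,r}$ one has $\varphi(bc)=\varphi(b)\varphi(c)$, and they commute in distribution, that is, $\tilde\varphi(z\,bc\,w)=\tilde\varphi(z\,cb\,w)$ for all $z,w$ in the unital subalgebra of $\widetilde{\mathcal A}$ generated by all the $\mathcal A_{i,\ell}$ and $\mathcal A_{i,r}$, $i\in K$. -/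

import Mathlib

noncomputable section

namespace BiMonotonic

universe u v

/-- The two faces: left and right. -/
inductive Side : Type
  | left
  | right
  deriving DecidableEq

/-! ### The order `≺_χ`, the partition `π_{χ,ω}` and moments -/

/-- The strict total order `≺_χ` on `{1, …, n}`: first the left indices in increasing order, then
the right indices in decreasing order. -/
def chiLT {n : ℕ} (χ : Fin n → Side) (i j : Fin n) : Prop :=
  match χ i, χ j with
  | Side.left, Side.left => i < j
  | Side.left, Side.right => True
  | Side.right, Side.left => False
  | Side.right, Side.right => j < i

/-- `i ≼_χ j`. -/
def chiLE {n : ℕ} (χ : Fin n → Side) (i j : Fin n) : Prop :=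
  i = j ∨ chiLT χ i j

open Classical in
/-- The block of `π_{χ,ω}` containing `i`: all `j` such that `ω` is constant on the `χ`-interval
with end points `i` and `j`. -/
def blockOf {κ : Type*} {n : ℕ} (χ : Fin n → Side) (ω : Fin n → κ) (i : Fin n) : Finset (Fin n) :=
  Finset.univ.filter fun j => ∀ x,
    (chiLE χ i x ∧ chiLE χ x j) ∨ (chiLE χ j x ∧ chiLE χ x i) → ω x = ω i

/-- The partition `π_{χ,ω}` of `{1, …, n}` into the maximal `χ`-intervals on which `ω` is
constant. -/
def blocks {κ : Type*} {n : ℕ} (χ : Fin n → Side) (ω : Fin n → κ) : Finset (Finset (Fin n)) :=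
  Finset.univ.image (blockOf χ ω)

/-- `V_1, …, V_m` are the blocks of `π_{χ,ω}` listed (each once) in the order `≺_χ`. -/
structure IsOrderedBlocks {κ : Type*} {n m : ℕ} (χ : Fin n → Side) (ω : Fin n → κ)
    (V : Fin m → Finset (Fin n)) : Prop where
  mem_iff : ∀ B : Finset (Fin n), B ∈ blocks χ ω ↔ ∃ k, V k = B
  lt : ∀ k k' : Fin m, k < k' → ∀ i ∈ V k, ∀ j ∈ V k', chiLT χ i j

/-- The product `a_V = a_{v_1} ⋯ a_{v_s}`, `V = {v_1 < ⋯ < v_s}`, in a unital algebra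
(`a_∅ = 1`). -/
def subword {C : Type*} [Semiring C] {n : ℕ} (a : Fin n → C) (V : Finset (Fin n)) : C :=
  (((List.finRange n).filter fun j => j ∈ V).map a).prod

/-- The product `a_1 ⋯ a_n` in a unital algebra. -/
def word {C : Type*} [Semiring C] {n : ℕ} (a : Fin n → C) : C :=
  (List.ofFn a).prod

section Functionals

variable {A : Type*} [NonUnitalSemiring A] [Module ℂ A] [IsScalarTower ℂ A A]
  [SMulCommClass ℂ A A]

/-- The unital linear extension `φ̃` of `φ` to the unitization. -/
def unitExt (φ : A →ₗ[ℂ] ℂ) : Unitization ℂ A →ₗ[ℂ] ℂ where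
  toFun x := x.fst + φ x.snd
  map_add' x y := by simp; ring
  map_smul' c x := by simp; ring

/-- The delta functional `λ1 + a ↦ λ` on the unitization. -/
def deltaFun (A : Type*) [NonUnitalSemiring A] [Module ℂ A] [IsScalarTower ℂ A A]
    [SMulCommClass ℂ A A] : Unitization ℂ A →ₗ[ℂ] ℂ :=
  (Unitization.fstHom ℂ A).toLinearMap

/-- The moment `φ(a_V)` of elements of a (not necessarily unital) algebra; it is `1` for
`V = ∅`. -/
def moment (φ : A →ₗ[ℂ] ℂ) {n : ℕ} (a : Fin n → A) (V : Finset (Fin n)) : ℂ :=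
  unitExt φ (subword (fun j => (Unitization.inr (a j) : Unitization ℂ A)) V)

end Functionals

/-! ### Free products without identification of units -/

/-- A (not necessarily unital) complex algebra. (Additive inverses are automatic.) -/
structure NUAlg : Type (u + 1) where
  carrier : Type u
  [semiring : NonUnitalSemiring carrier]
  [module : Module ℂ carrier]
  [tower : IsScalarTower ℂ carrier carrier]
  [comm : SMulCommClass ℂ carrier carrier]

instance : CoeSort NUAlg.{u} (Type u) := ⟨NUAlg.carrier⟩

attribute [instance] NUAlg.semiring NUAlg.module NUAlg.tower NUAlg.comm

/-- The free product, with identification of units, of the unitizations of the `A i`. -/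
abbrev UnitalFree {I : Type} [DecidableEq I] (A : I → NUAlg.{u}) : Type u :=
  LinearAlgebra.FreeProduct ℂ fun i => Unitization ℂ (A i)

/-- The canonical embedding of `A i` in the free product of the unitizations. -/
def UnitalFree.of {I : Type} [DecidableEq I] (A : I → NUAlg.{u}) (i : I) :
    A i →ₙₐ[ℂ] UnitalFree A :=
  ((LinearAlgebra.FreeProduct.ι ℂ (fun i => Unitization ℂ (A i)) i :
      Unitization ℂ (A i) →ₐ[ℂ] UnitalFree A) : Unitization ℂ (A i) →ₙₐ[ℂ] UnitalFree A).comp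
    (Unitization.inrNonUnitalAlgHom ℂ (A i))

/-- The free product `⊔ᵢ A i` without identification of units as a subalgebra of the free product
of the unitizations: the span of all non-empty words in elements of the `A i`. -/
def freeSub {I : Type} [DecidableEq I] (A : I → NUAlg.{u}) :
    NonUnitalSubalgebra ℂ (UnitalFree A) :=
  NonUnitalAlgebra.adjoin ℂ (⋃ i, Set.range (UnitalFree.of A i))

/-- The free product `⊔ᵢ A i` without identification of units. -/
def free {I : Type} [DecidableEq I] (A : I → NUAlg.{u}) : NUAlg.{u} where
  carrier := freeSub A

/-- The canonical embedding `A i → ⊔ᵢ A i`. -/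
def free.of {I : Type} [DecidableEq I] (A : I → NUAlg.{u}) (i : I) : A i →ₙₐ[ℂ] free A :=
  NonUnitalAlgHom.codRestrict (UnitalFree.of A i) (freeSub A) fun x =>
    NonUnitalAlgebra.subset_adjoin ℂ (Set.mem_iUnion.2 ⟨i, x, rfl⟩)

/-- The unital homomorphism from the free product of the unitizations to the unitization of `B`
induced by homomorphisms `A i → B`. -/
def UnitalFree.lift {I : Type} [DecidableEq I] (A : I → NUAlg.{u}) {B : Type v}
    [NonUnitalSemiring B] [Module ℂ B] [IsScalarTower ℂ B B] [SMulCommClass ℂ B B]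
    (f : ∀ i, A i →ₙₐ[ℂ] B) : UnitalFree A →ₐ[ℂ] Unitization ℂ B :=
  LinearAlgebra.FreeProduct.lift ℂ (fun i => Unitization ℂ (A i))
    (fun {i} => Unitization.lift ((Unitization.inrNonUnitalAlgHom ℂ B).comp (f i)))

theorem UnitalFree.lift_of {I : Type} [DecidableEq I] (A : I → NUAlg.{u}) {B : Type v}
    [NonUnitalSemiring B] [Module ℂ B] [IsScalarTower ℂ B B] [SMulCommClass ℂ B B]
    (f : ∀ i, A i →ₙₐ[ℂ] B) (i : I) (a : A i) :
    UnitalFree.lift A f (UnitalFree.of A i a) = Unitization.inr (f i a) := by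
  have h := DFunLike.congr_fun (LinearAlgebra.FreeProduct.lift_comp_ι ℂ
    (fun i => Unitization ℂ (A i)) (i := i)
    (fun {i} => Unitization.lift ((Unitization.inrNonUnitalAlgHom ℂ B).comp (f i))))
    (Unitization.inr a)
  exact h.trans (by simp)

theorem UnitalFree.fst_lift {I : Type} [DecidableEq I] (A : I → NUAlg.{u}) {B : Type v}
    [NonUnitalSemiring B] [Module ℂ B] [IsScalarTower ℂ B B] [SMulCommClass ℂ B B]
    (f : ∀ i, A i →ₙₐ[ℂ] B) (x : UnitalFree A) (hx : x ∈ freeSub A) :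
    (UnitalFree.lift A f x).fst = 0 := by
  induction hx using NonUnitalAlgebra.adjoin_induction with
  | mem x hx =>
    obtain ⟨i, a, rfl⟩ := Set.mem_iUnion.1 hx
    simp [UnitalFree.lift_of]
  | add x y _ _ hx hy => simp [hx, hy]
  | zero => simp
  | mul x y _ _ hx hy => simp [hx]
  | smul c x _ hx => simp [hx]

/-- The universal property of `⊔ᵢ A i`: homomorphisms `f i : A i → B` extend to
`⊔ᵢ A i → B`. -/
def free.lift {I : Type} [DecidableEq I] (A : I → NUAlg.{u}) {B : Type v}
    [NonUnitalSemiring B] [Module ℂ B] [IsScalarTower ℂ B B] [SMulCommClass ℂ B B]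
    (f : ∀ i, A i →ₙₐ[ℂ] B) : free A →ₙₐ[ℂ] B where
  toFun x := (UnitalFree.lift A f x.1).snd
  map_smul' c x := by
    change (UnitalFree.lift A f (c • x.1)).snd = c • (UnitalFree.lift A f x.1).snd
    simp
  map_zero' := by
    change (UnitalFree.lift A f 0).snd = 0
    simp
  map_add' x y := by
    change (UnitalFree.lift A f (x.1 + y.1)).snd = _
    simp
  map_mul' x y := by
    change (UnitalFree.lift A f (x.1 * y.1)).snd = _
    simp [UnitalFree.fst_lift A f x.1 x.2, UnitalFree.fst_lift A f y.1 y.2]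

theorem free.lift_of {I : Type} [DecidableEq I] (A : I → NUAlg.{u}) {B : Type v}
    [NonUnitalSemiring B] [Module ℂ B] [IsScalarTower ℂ B B] [SMulCommClass ℂ B B]
    (f : ∀ i, A i →ₙₐ[ℂ] B) (i : I) (a : A i) :
    free.lift A f (free.of A i a) = f i a := by
  change (UnitalFree.lift A f (UnitalFree.of A i a)).snd = f i a
  simp [UnitalFree.lift_of]

/-! ### Conditionally bi-free independence and products -/

/-- A family of pairs `(B k left, B k right)` of unital subalgebras is conditionally bi-free
with respect to the pair `(φ, ψ)` of functionals. -/
def IsCBiFree {C : Type*} [Semiring C] [Algebra ℂ C] {κ : Type*}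
    (φ ψ : C →ₗ[ℂ] ℂ) (B : κ → Side → Subalgebra ℂ C) : Prop :=
  ∀ (n : ℕ) (χ : Fin n → Side) (ω : Fin n → κ) (a : Fin n → C), 1 ≤ n →
    (∀ j, a j ∈ B (ω j) (χ j)) →
    (∀ V ∈ blocks χ ω, ψ (subword a V) = 0) →
      ψ (word a) = 0 ∧ φ (word a) = ∏ V ∈ blocks χ ω, φ (subword a V)

/-- The copy of the unitization of `A_ε` inside the unitization of `A_ℓ ⊔ A_r`. -/
def unitFace (A : Side → NUAlg.{u}) (ε : Side) : Subalgebra ℂ (Unitization ℂ (free A)) :=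
  (Unitization.lift ((Unitization.inrNonUnitalAlgHom ℂ (free A)).comp (free.of A ε))).range

/-- Given, for each `k ∈ κ`, a pair of algebras `(A_{k,ℓ}, A_{k,r})` and unital functionals
`φ k`, `ψ k` on the unitization of `A_{k,ℓ} ⊔ A_{k,r}` (which is the unital free product of the
unitizations of the two faces), `(Φ, Ψ)` is the conditionally bi-free product of the pairs
`(φ k, ψ k)`. -/
structure IsCBiFreeProduct {κ : Type} [DecidableEq κ] (A : κ → Side → NUAlg.{u})
    (φ ψ : ∀ k, Unitization ℂ (free (A k)) →ₗ[ℂ] ℂ)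
    (Φ Ψ : UnitalFree (fun k => free (A k)) →ₗ[ℂ] ℂ) : Prop where
  restrict_left : ∀ k x,
    Φ (LinearAlgebra.FreeProduct.ι ℂ (fun k => Unitization ℂ (free (A k))) k x) = φ k x
  restrict_right : ∀ k x,
    Ψ (LinearAlgebra.FreeProduct.ι ℂ (fun k => Unitization ℂ (free (A k))) k x) = ψ k x
  cbifree : IsCBiFree Φ Ψ fun k ε =>
    (unitFace (A k) ε).map (LinearAlgebra.FreeProduct.ι ℂ (fun k => Unitization ℂ (free (A k))) k)

/-- `Θ`, a functional on `(A_{1,ℓ} ⊔ A_{1,r}) ⊔ (A_{2,ℓ} ⊔ A_{2,r})`, is the bi-monotonic product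
`φ₁ ▷▷ φ₂`: it is the restriction of the first component `Φ` of the conditionally bi-free product
`(Φ, Ψ)` of `(φ̃₁, δ₁)` and `(φ̃₂, φ̃₂)`. The pairs are `A 0` (first) and `A 1` (second). -/
def IsBiMonotonicProduct (A : Fin 2 → Side → NUAlg.{u})
    (φ₁ : free (A 0) →ₗ[ℂ] ℂ) (φ₂ : free (A 1) →ₗ[ℂ] ℂ)
    (Θ : free (fun k => free (A k)) →ₗ[ℂ] ℂ) : Prop :=
  ∃ Φ Ψ : UnitalFree (fun k => free (A k)) →ₗ[ℂ] ℂ,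
    IsCBiFreeProduct A
      (fun | 0 => unitExt φ₁ | 1 => unitExt φ₂)
      (fun | 0 => deltaFun (free (A 0)) | 1 => unitExt φ₂) Φ Ψ ∧
    ∀ x : freeSub (fun k => free (A k)), Θ x = Φ x.1

/-! ### Iterated bi-monotonic products -/

/-- The pair of faces `(A_{1,ℓ} ⊔ A_{2,ℓ}, A_{1,r} ⊔ A_{2,r})`. -/
def joinFaces (A : Fin 2 → Side → NUAlg.{u}) (ε : Side) : NUAlg.{u} :=
  free fun k => A k ε

/-- The canonical identification
`(A_{1,ℓ} ⊔ A_{2,ℓ}) ⊔ (A_{1,r} ⊔ A_{2,r}) → (A_{1,ℓ} ⊔ A_{1,r}) ⊔ (A_{2,ℓ} ⊔ A_{2,r})`. -/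
def regroup (A : Fin 2 → Side → NUAlg.{u}) :
    free (joinFaces A) →ₙₐ[ℂ] free (fun k => free (A k)) :=
  free.lift (joinFaces A) fun ε =>
    free.lift (fun k => A k ε) fun k =>
      (free.of (fun k => free (A k)) k).comp (free.of (A k) ε)

/-- The faces of the iterated product of the pairs `A 0, …, A m`, bracketed from the left. -/
def iterFaces (A : ℕ → Side → NUAlg.{u}) : ℕ → Side → NUAlg.{u}
  | 0 => A 0
  | m + 1 => joinFaces ![iterFaces A m, A (m + 1)]

/-- `Φ` is the iterated bi-monotonic product `((φ 0 ▷▷ φ 1) ▷▷ ⋯) ▷▷ φ m`. -/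
def IsIteratedProduct (A : ℕ → Side → NUAlg.{u}) (φ : ∀ k, free (A k) →ₗ[ℂ] ℂ) :
    ∀ m : ℕ, (free (iterFaces A m) →ₗ[ℂ] ℂ) → Prop
  | 0, Φ => Φ = φ 0
  | m + 1, Φ =>
      ∃ (Φ' : free (iterFaces A m) →ₗ[ℂ] ℂ)
        (Θ : free (fun k => free ((![iterFaces A m, A (m + 1)] : Fin 2 → Side → NUAlg.{u}) k))
          →ₗ[ℂ] ℂ),
        IsIteratedProduct A φ m Φ' ∧
        IsBiMonotonicProduct ![iterFaces A m, A (m + 1)] Φ' (φ (m + 1)) Θ ∧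
        ∀ x, Φ x = Θ (regroup ![iterFaces A m, A (m + 1)] x)

/-- The canonical homomorphisms from the faces of the iterated product to an algebra `B` in which
the faces of the pairs `A 0, …, A m` are realized through `f`. -/
def iterHom (A : ℕ → Side → NUAlg.{u}) {B : Type v}
    [NonUnitalSemiring B] [Module ℂ B] [IsScalarTower ℂ B B] [SMulCommClass ℂ B B]
    (f : ∀ k ε, A k ε →ₙₐ[ℂ] B) : ∀ (m : ℕ) (ε : Side), iterFaces A m ε →ₙₐ[ℂ] B
  | 0, ε => f 0 ε
  | m + 1, ε =>
      free.lift (fun k => (![iterFaces A m, A (m + 1)] : Fin 2 → Side → NUAlg.{u}) k ε)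
        fun | 0 => iterHom A f m ε | 1 => f (m + 1) ε

section Independence

variable {A : Type u} [NonUnitalRing A] [Module ℂ A] [IsScalarTower ℂ A A] [SMulCommClass ℂ A A]

/-- A subalgebra as an algebra in its own right. -/
def toNUAlg (B : NonUnitalSubalgebra ℂ A) : NUAlg.{u} where
  carrier := B

/-- The joint distribution with respect to `φ` of a pair of algebras mapped to `A` by `f`: the
functional obtained by composing the canonical map from the free product with `φ`. -/
def jointDist (φ : A →ₗ[ℂ] ℂ) (F : Side → NUAlg.{u}) (f : ∀ ε, F ε →ₙₐ[ℂ] A) :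
    free F →ₗ[ℂ] ℂ where
  toFun x := φ (free.lift F f x)
  map_add' x y := by simp
  map_smul' c x := by simp

/-- The linearly ordered family of pairs `(B k left, B k right)` is bi-monotonically independent
(of type I) with respect to `φ`: for all indices `k 0 < ⋯ < k m`, the joint distribution of the
corresponding pairs is the bi-monotonic product of the distributions of the single pairs. -/
def IsBiMonotonicallyIndependent {K : Type*} [LinearOrder K] (φ : A →ₗ[ℂ] ℂ)
    (B : K → Side → NonUnitalSubalgebra ℂ A) : Prop :=
  ∀ (m : ℕ) (k : ℕ → K), StrictMonoOn k (Set.Iic m) →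
    IsIteratedProduct (fun i ε => toNUAlg (B (k i) ε))
      (fun i => jointDist φ (fun ε => toNUAlg (B (k i) ε))
        fun ε => NonUnitalSubalgebraClass.subtype (B (k i) ε))
      m
      (jointDist φ (iterFaces (fun i ε => toNUAlg (B (k i) ε)) m)
        (iterHom (fun i ε => toNUAlg (B (k i) ε))
          (fun i ε => NonUnitalSubalgebraClass.subtype (B (k i) ε)) m))

/-- Monotonic independence of a linearly ordered family of algebras. -/
def IsMonotonicallyIndependent {K : Type*} [LinearOrder K] (φ : A →ₗ[ℂ] ℂ)
    (B : K → NonUnitalSubalgebra ℂ A) : Prop :=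
  ∀ (n : ℕ) (ω : Fin n → K) (a : Fin n → A), (∀ j, a j ∈ B (ω j)) →
    ∀ p : Fin n,
      (∀ q : Fin n, (q : ℕ) + 1 = p ∨ (q : ℕ) = p + 1 → ω q < ω p) →
      moment φ a Finset.univ = φ (a p) * moment φ a (Finset.univ.erase p)

/-- Classical independence of `B` and `C` with respect to `φ`: the moment of a product is the
product of the moments, and `B` and `C` commute in distribution, that is, elements of `B` and `C`
which stand next to each other in a product of elements of the ambient algebra `G ⊇ B ∪ C` may be
interchanged under `φ`. (The factors `z`, `w` before and after them range over the unitization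
of `G`, so that they may be absent.) -/
structure IsClassicallyIndependent (φ : A →ₗ[ℂ] ℂ) (G B C : NonUnitalSubalgebra ℂ A) : Prop where
  map_mul : ∀ b ∈ B, ∀ c ∈ C, φ (b * c) = φ b * φ c
  commute : ∀ b ∈ B, ∀ c ∈ C, ∀ z w : Unitization ℂ A, z.snd ∈ G → w.snd ∈ G →
    unitExt φ (z * Unitization.inr (b * c) * w) = unitExt φ (z * Unitization.inr (c * b) * w)

end Independence

end BiMonotonic

end

open BiMonotonic

/-!
Throughout, a set `S` of positions of a word stands for the word in which the other positions carry
the unit, and a peak of `S` (`IsPeak`) is a maximal `≺_χ`-interval of `S` on which `ω` is constant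
and next to which `ω` is smaller. The heart of the matter is that every peak `V` factorizes:
`φ(a_S) = φ(a_V) φ(a_{S \ V})` (`moment_eq_mul_of_isPeak`).

*Two pairs.* Let `(Φ, Ψ)` be the conditionally bi-free product of `(φ̃₁, δ₁)` and `(φ̃₂, φ̃₂)`. On
non-empty words in the first pair `Ψ` vanishes, so only the blocks of the second pair have to be
centred before the definition of conditional bi-freeness applies, and `Φ` is then zero, as `Φ = Ψ`
on the second pair. The entries of a block are not adjacent in the word, so a block cannot be
centred by subtracting a constant. Instead, the moments `Φ(a_S)` and `Ψ(a_V)` are regarded as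
multilinear forms in the entries of `V`. The first vanishes wherever the second does, hence they are
proportional (`exists_eq_mul_of_zero_imp_zero`), and unit entries show that the factor is
`Φ(a_{S \ V})` (`map_word_eq_mul_of_zero_imp_zero`, `map_word_eq_mul`). Units outside `S` do no
harm: they are assigned to the pair of a neighbour in `S` by means of a monotone retraction onto `S`.

*Many pairs.* If `V` is a block with the largest index occurring in `S`, only the outermost of the
iterated products matters, and the case of two pairs applies
(`moment_eq_mul_of_isPeak_of_le`). For an arbitrary peak, blocks with the largest index are
removed first; the removal of one peak leaves the others intact (`IsPeak.sdiff`).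

*Consequences.* The first assertion is the case of all positions, and in a word from one face `≺_χ`
is the usual order or its reverse, so that single letters with a locally largest index are peaks.
A left and a right letter that are neighbours may be interchanged without affecting the order
`≺_χ`; if their indices differ, no block contains both, and splitting off blocks shows that the
moment does not change (`moment_comp_swap`).
-/

namespace BiMonotonic

universe u v

/-! ### Multilinear forms with nested zero sets -/

/-- Two multilinear forms are proportional if one vanishes wherever the other does. Here `F` and `G`
are linear in each coordinate in `Y`, the remaining coordinates are those of `a`, and the
coordinate `j ∈ Y` ranges over `N j`. The induction step compares the factors `c v` that belong to
the values `v` of a new coordinate: the forms `G (v, ·)` and `G (v', ·)` are proportional or force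
`c v = c (v + v') = c v'`. -/
theorem exists_eq_mul_of_zero_imp_zero {ι C : Type*} [DecidableEq ι] [AddCommMonoid C] [Module ℂ C]
    (N : ι → Submodule ℂ C) (F G : (ι → C) → ℂ) (Y : Finset ι)
    (hF : ∀ i ∈ Y, ∀ (b : ι → C) (x y : C) (s t : ℂ),
      F (Function.update b i (s • x + t • y)) =
        s * F (Function.update b i x) + t * F (Function.update b i y))
    (hG : ∀ i ∈ Y, ∀ (b : ι → C) (x y : C) (s t : ℂ),
      G (Function.update b i (s • x + t • y)) =
        s * G (Function.update b i x) + t * G (Function.update b i y))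
    (a : ι → C)
    (h : ∀ b, (∀ j ∈ Y, b j ∈ N j) → (∀ j ∉ Y, b j = a j) → G b = 0 → F b = 0) :
    ∃ c : ℂ, ∀ b, (∀ j ∈ Y, b j ∈ N j) → (∀ j ∉ Y, b j = a j) → F b = c * G b := by
  induction Y using Finset.induction_on generalizing a with
  | empty =>
    have hb : ∀ b : ι → C, (∀ j ∉ (∅ : Finset ι), b j = a j) → b = a :=
      fun b hb => funext fun j => hb j (by simp)
    by_cases hz : G a = 0
    · refine ⟨0, fun b h1 h2 => ?_⟩
      rw [hb b h2, h a (by simp) (by simp) hz, zero_mul]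
    · refine ⟨F a / G a, fun b _ h2 => ?_⟩
      rw [hb b h2, div_mul_cancel₀ _ hz]
  | insert i Y hi ih =>
    -- `b` ranges over the tuples that agree with `a` outside `insert i Y`
    let Q : (ι → C) → Prop := fun b => (∀ j ∈ insert i Y, b j ∈ N j) ∧ ∀ j ∉ insert i Y, b j = a j
    have hQ : ∀ b, Q b → ∀ v ∈ N i, Q (Function.update b i v) := by
      intro b hb v hv
      refine ⟨fun j hj => ?_, fun j hj => ?_⟩
      · by_cases hji : j = i
        · subst hji; simpa using hv
        · simpa [hji] using hb.1 j hj
      · have hji : j ≠ i := by rintro rfl; exact hj (Finset.mem_insert_self _ _)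
        simpa [hji] using hb.2 j hj
    have key : ∀ v ∈ N i, ∃ c : ℂ, ∀ b, Q b →
        F (Function.update b i v) = c * G (Function.update b i v) := by
      intro v hv
      obtain ⟨c, hc⟩ := ih (fun j hj => hF j (Finset.mem_insert_of_mem hj))
        (fun j hj => hG j (Finset.mem_insert_of_mem hj)) (Function.update a i v) (by
          intro b h1 h2 h3
          refine h b (fun j hj => ?_) (fun j hj => ?_) h3
          · rcases Finset.mem_insert.1 hj with rfl | hj
            · rw [h2 j hi]; simpa using hv
            · exact h1 j hj
          · have hji : j ≠ i := by rintro rfl; exact hj (Finset.mem_insert_self _ _)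
            rw [h2 j (fun hj' => hj (Finset.mem_insert_of_mem hj'))]
            simp [hji])
      refine ⟨c, fun b hb => hc _ (fun j hj => (hQ b hb v hv).1 j (Finset.mem_insert_of_mem hj))
        fun j hj => ?_⟩
      by_cases hji : j = i
      · subst hji; simp
      · simpa [hji] using hb.2 j (by simp [hji, hj])
    by_cases hz : ∀ b, Q b → G b = 0
    · exact ⟨0, fun b h1 h2 => by rw [h b h1 h2 (hz b ⟨h1, h2⟩), zero_mul]⟩
    push Not at hz
    obtain ⟨b0, hb0, hG0⟩ := hz
    have hv0 : b0 i ∈ N i := hb0.1 i (Finset.mem_insert_self _ _)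
    obtain ⟨c0, hc0⟩ := key _ hv0
    refine ⟨c0, fun b h1 h2 => ?_⟩
    have hb : Q b := ⟨h1, h2⟩
    have hv : b i ∈ N i := h1 i (Finset.mem_insert_self _ _)
    -- either `G (v, ·)` is a multiple of `G (v₀, ·)`, or the two forms are independent
    by_cases hprop : ∃ μ : ℂ, ∀ b', Q b' →
        G (Function.update b' i (b i)) = μ * G (Function.update b' i (b0 i))
    · obtain ⟨μ, hμ⟩ := hprop
      have hw : (1 : ℂ) • b i + (-μ) • b0 i ∈ N i :=
        add_mem (Submodule.smul_mem _ _ hv) (Submodule.smul_mem _ _ hv0)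
      have h3 := hQ b hb _ hw
      have h4 := h _ h3.1 h3.2 (by
        rw [hG i (Finset.mem_insert_self _ _), hμ b hb]; ring)
      rw [hF i (Finset.mem_insert_self _ _), hc0 b hb] at h4
      have h5 := hμ b hb
      rw [Function.update_eq_self] at h4 h5
      rw [h5]
      linear_combination h4
    · obtain ⟨cv, hcv⟩ := key _ hv
      have hw : (1 : ℂ) • b i + (1 : ℂ) • b0 i ∈ N i :=
        add_mem (Submodule.smul_mem _ _ hv) (Submodule.smul_mem _ _ hv0)
      obtain ⟨c', hc'⟩ := key _ hw
      have h6 : ∀ b', Q b' → (cv - c') * G (Function.update b' i (b i)) +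
          (c0 - c') * G (Function.update b' i (b0 i)) = 0 := by
        intro b' hb'
        have := hc' b' hb'
        rw [hF i (Finset.mem_insert_self _ _), hG i (Finset.mem_insert_self _ _), hcv b' hb',
          hc0 b' hb'] at this
        linear_combination this
      have h7 : cv = c' := by
        by_contra hne
        have hne' : cv - c' ≠ 0 := sub_ne_zero.2 hne
        refine hprop ⟨-(c0 - c') / (cv - c'), fun b' hb' => ?_⟩
        field_simp
        linear_combination h6 b' hb'
      have h8 := h6 b0 hb0
      rw [h7, sub_self, zero_mul, zero_add, Function.update_eq_self] at h8
      have h9 : c0 = c' := sub_eq_zero.1 ((mul_eq_zero.1 h8).resolve_right hG0)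
      have h10 := hcv b hb
      rw [Function.update_eq_self] at h10
      rw [h10, h7, h9]

/-! ### Subwords as words with unit entries -/

/-- The tuple `a` with the entries outside `S` replaced by `1`. -/
def mask {ι C : Type*} [DecidableEq ι] [One C] (a : ι → C) (S : Finset ι) (j : ι) : C :=
  if j ∈ S then a j else 1

theorem word_mask {C : Type*} [Semiring C] {n : ℕ} (a : Fin n → C) (S : Finset (Fin n)) :
    word (mask a S) = subword a S := by
  unfold word subword
  rw [List.ofFn_eq_map]
  induction List.finRange n with
  | nil => simp
  | cons j l ih =>
    by_cases hj : j ∈ S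
    · simp [mask, hj] at ih ⊢
      rw [ih]
    · simp [mask, hj] at ih ⊢
      rw [ih]

theorem mask_univ {ι C : Type*} [Fintype ι] [DecidableEq ι] [One C] (a : ι → C) :
    mask a Finset.univ = a := by
  funext j; simp [mask]

theorem word_mask_empty {C : Type*} [Semiring C] {n : ℕ} (a : Fin n → C) :
    word (mask a ∅) = 1 := by
  rw [word_mask]; simp [subword]

theorem mask_congr {ι C : Type*} [DecidableEq ι] [One C] {a b : ι → C} {S : Finset ι}
    (h : ∀ j ∈ S, a j = b j) : mask a S = mask b S := by
  funext j
  by_cases hj : j ∈ S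
  · simp [mask, hj, h j hj]
  · simp [mask, hj]

theorem mask_mask {ι C : Type*} [DecidableEq ι] [One C] (a : ι → C) (S T : Finset ι) :
    mask (mask a S) T = mask a (T ∩ S) := by
  funext j
  by_cases h1 : j ∈ S <;> by_cases h2 : j ∈ T <;> simp [mask, h1, h2]

theorem word_mask_update {C : Type*} [Semiring C] [Algebra ℂ C] {n : ℕ} (φ : C →ₗ[ℂ] ℂ)
    {S : Finset (Fin n)} {i : Fin n} (hi : i ∈ S) (b : Fin n → C) (x y : C) (s t : ℂ) :
    φ (word (mask (Function.update b i (s • x + t • y)) S)) =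
      s * φ (word (mask (Function.update b i x) S)) +
        t * φ (word (mask (Function.update b i y) S)) := by
  have h : ∀ z, mask (Function.update b i z) S = Function.update (mask b S) i z := by
    intro z; funext j
    by_cases hj : j = i
    · subst hj; simp [mask, hi]
    · simp [mask, hj]
  have hw : ∀ c : Fin n → C, word c = MultilinearMap.mkPiAlgebraFin ℂ n C c := fun c => by
    simp [word]
  simp only [h, hw, MultilinearMap.map_update_add, MultilinearMap.map_update_smul, map_add,
    map_smul, smul_eq_mul]

/-! ### The rank function of `≺_χ` -/

/-- A rank function of the order `≺_χ`. -/
def chiRank {n : ℕ} (χ : Fin n → Side) (i : Fin n) : ℕ :=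
  match χ i with
  | Side.left => i
  | Side.right => 2 * n - i

theorem chiLT_iff {n : ℕ} (χ : Fin n → Side) (i j : Fin n) :
    chiLT χ i j ↔ chiRank χ i < chiRank χ j := by
  unfold chiLT chiRank
  have := i.2
  have := j.2
  cases χ i <;> cases χ j <;> simp only [Fin.lt_def, true_iff, false_iff] <;> omega

theorem chiRank_injective {n : ℕ} (χ : Fin n → Side) : Function.Injective (chiRank χ) := by
  intro i j h
  unfold chiRank at h
  have := i.2
  have := j.2
  apply Fin.ext
  cases hi : χ i <;> cases hj : χ j <;> simp only [hi, hj] at h <;> omega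

theorem chiLE_iff {n : ℕ} (χ : Fin n → Side) (i j : Fin n) :
    chiLE χ i j ↔ chiRank χ i ≤ chiRank χ j := by
  rw [chiLE, chiLT_iff, le_iff_eq_or_lt, (chiRank_injective χ).eq_iff]

theorem mem_blockOf {κ : Type*} {n : ℕ} (χ : Fin n → Side) (ω : Fin n → κ) (i j : Fin n) :
    j ∈ blockOf χ ω i ↔
      ∀ x, chiRank χ x ∈ Set.uIcc (chiRank χ i) (chiRank χ j) → ω x = ω i := by
  simp only [blockOf, Finset.mem_filter, Finset.mem_univ, true_and, chiLE_iff, Set.mem_uIcc]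

/-! ### Blocks and peaks of a finite set -/

open Classical in
/-- The block containing `i` of the partition of `S` into the maximal `ρ`-intervals on which `ω`
is constant. -/
noncomputable def blockIn {ι κ : Type*} (ρ : ι → ℕ) (ω : ι → κ) (S : Finset ι) (i : ι) : Finset ι :=
  S.filter fun j => ∀ x ∈ S, ρ x ∈ Set.uIcc (ρ i) (ρ j) → ω x = ω i

/-- `V` is empty or a maximal `ρ`-interval of `S` on which `ω` is constant, and `ω` takes smaller
values on the elements of `S` next to `V`. The last condition is expressed without naming these
neighbours: any element of `S` outside `V` with at least the value of `V` is separated from `V` by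
a smaller value. -/
structure IsPeak {ι κ : Type*} [LinearOrder κ] (ρ : ι → ℕ) (ω : ι → κ) (S V : Finset ι) :
    Prop where
  subset : V ⊆ S
  const : ∀ i ∈ V, ∀ j ∈ V, ω i = ω j
  convex : ∀ i ∈ V, ∀ j ∈ V, ∀ x ∈ S, ρ x ∈ Set.uIcc (ρ i) (ρ j) → x ∈ V
  lower : ∀ i ∈ V, ∀ j ∈ S, j ∉ V → ω i ≤ ω j →
    ∃ x ∈ S, ρ x ∈ Set.uIcc (ρ i) (ρ j) ∧ ω x < ω i

section Peak

variable {ι κ : Type*} {ρ : ι → ℕ} {ω : ι → κ} {S U V : Finset ι} {i j : ι}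

theorem mem_blockIn :
    j ∈ blockIn ρ ω S i ↔ j ∈ S ∧ ∀ x ∈ S, ρ x ∈ Set.uIcc (ρ i) (ρ j) → ω x = ω i := by
  simp [blockIn]

theorem self_mem_blockIn (hρ : Function.Injective ρ) (hi : i ∈ S) : i ∈ blockIn ρ ω S i := by
  refine mem_blockIn.2 ⟨hi, fun x _ hx => ?_⟩
  rw [Set.uIcc_self, Set.mem_singleton_iff] at hx
  rw [hρ hx]

theorem blockIn_subset : blockIn ρ ω S i ⊆ S := fun _ h => (mem_blockIn.1 h).1

theorem apply_eq_of_mem_blockIn (h : j ∈ blockIn ρ ω S i) : ω j = ω i :=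
  (mem_blockIn.1 h).2 j (mem_blockIn.1 h).1 Set.right_mem_uIcc

/-- Blocks are intervals of `S`. -/
theorem blockIn_convex {x y z : ι} (hx : x ∈ blockIn ρ ω S i) (hy : y ∈ blockIn ρ ω S i)
    (hz : z ∈ S) (hzxy : ρ z ∈ Set.uIcc (ρ x) (ρ y)) : z ∈ blockIn ρ ω S i := by
  rw [mem_blockIn] at hx hy ⊢
  refine ⟨hz, fun w hw hwz => ?_⟩
  have h : ρ w ∈ Set.uIcc (ρ i) (ρ x) ∨ ρ w ∈ Set.uIcc (ρ i) (ρ y) := by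
    rw [Set.mem_uIcc] at *; rw [Set.mem_uIcc]; omega
  rcases h with h | h
  · exact hx.2 w hw h
  · exact hy.2 w hw h

theorem isPeak_blockIn [LinearOrder κ] (hmax : ∀ j ∈ S, ω j ≤ ω i) :
    IsPeak ρ ω S (blockIn ρ ω S i) where
  subset := blockIn_subset
  const x hx y hy := (apply_eq_of_mem_blockIn hx).trans (apply_eq_of_mem_blockIn hy).symm
  convex x hx y hy z hz hzxy := blockIn_convex hx hy hz hzxy
  lower x hx j hj hjn hle := by
    have hxi := apply_eq_of_mem_blockIn hx
    rw [mem_blockIn] at hx hjn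
    push Not at hjn
    obtain ⟨z, hz, hzj, hne⟩ := hjn hj
    have hlt : ω z < ω i := lt_of_le_of_ne (hmax z hz) hne
    refine ⟨z, hz, ?_, hxi ▸ hlt⟩
    have h : ρ z ∉ Set.uIcc (ρ i) (ρ x) := fun h => hne (hx.2 z hz h)
    rw [Set.mem_uIcc] at *; omega

theorem IsPeak.eq_blockIn [LinearOrder κ] (hV : IsPeak ρ ω S V) (hi : i ∈ V) :
    V = blockIn ρ ω S i := by
  ext j
  rw [mem_blockIn]
  constructor
  · intro hj
    exact ⟨hV.subset hj, fun x hx hxj => hV.const x (hV.convex i hi j hj x hx hxj) i hi⟩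
  · rintro ⟨hj, h⟩
    by_contra hjn
    obtain ⟨x, hx, hxj, hlt⟩ := hV.lower i hi j hj hjn (h j hj Set.right_mem_uIcc).ge
    exact hlt.ne (h x hx hxj)

/-- A peak remains a peak when a disjoint peak `U` is removed: if an element of `U` was needed to
separate `V` from some `j`, then a smaller value next to `U` takes its place. -/
theorem IsPeak.sdiff [DecidableEq ι] [LinearOrder κ] (hU : IsPeak ρ ω S U) (hV : IsPeak ρ ω S V)
    (hd : Disjoint U V) : IsPeak ρ ω (S \ U) V where
  subset x hx := Finset.mem_sdiff.2 ⟨hV.subset hx, fun h => Finset.disjoint_left.1 hd h hx⟩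
  const := hV.const
  convex x hx y hy z hz := hV.convex x hx y hy z (Finset.mem_sdiff.1 hz).1
  lower x hx j hj hjn hle := by
    rw [Finset.mem_sdiff] at hj
    obtain ⟨z, hz, hzj, hlt⟩ := hV.lower x hx j hj.1 hjn hle
    by_cases hzU : z ∈ U
    · -- the witness lies in `U`; the element of `S` between `U` and `j` is a new one
      obtain ⟨y, hy, hyj, hlt'⟩ := hU.lower z hzU j hj.1 hj.2 (hlt.le.trans hle)
      refine ⟨y, Finset.mem_sdiff.2 ⟨hy, fun h => hlt'.ne (hU.const y h z hzU)⟩, ?_,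
        hlt'.trans hlt⟩
      rw [Set.mem_uIcc] at *; omega
    · exact ⟨z, Finset.mem_sdiff.2 ⟨hz, hzU⟩, hzj, hlt⟩

end Peak

/-- Every finite set `S` is the image of a monotone retraction. -/
theorem exists_monotone_retraction {ι : Type*} (ρ : ι → ℕ) (hρ : Function.Injective ρ)
    {S : Finset ι} (hS : S.Nonempty) :
    ∃ g : ι → ι, (∀ j, g j ∈ S) ∧ (∀ j ∈ S, g j = j) ∧ ∀ i j, ρ i ≤ ρ j → ρ (g i) ≤ ρ (g j) := by
  classical
  have h : ∀ j, ∃ s ∈ S, (ρ s ≤ ρ j ∧ ∀ t ∈ S, ρ t ≤ ρ j → ρ t ≤ ρ s) ∨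
      ∀ t ∈ S, ρ j < ρ t ∧ ρ s ≤ ρ t := by
    intro j
    by_cases hj : (S.filter fun t => ρ t ≤ ρ j).Nonempty
    · obtain ⟨s, hs, hmax⟩ := Finset.exists_max_image _ ρ hj
      rw [Finset.mem_filter] at hs
      exact ⟨s, hs.1, Or.inl ⟨hs.2, fun t ht htj => hmax t (Finset.mem_filter.2 ⟨ht, htj⟩)⟩⟩
    · obtain ⟨s, hs, hmin⟩ := Finset.exists_min_image _ ρ hS
      refine ⟨s, hs, Or.inr fun t ht => ⟨?_, hmin t ht⟩⟩
      by_contra hlt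
      exact hj ⟨t, Finset.mem_filter.2 ⟨ht, not_lt.1 hlt⟩⟩
  choose g hgS hg using h
  refine ⟨g, hgS, fun j hj => hρ ?_, fun i j hij => ?_⟩
  · rcases hg j with h | h
    · exact le_antisymm h.1 (h.2 j hj le_rfl)
    · exact absurd (h j hj).1 (lt_irrefl _)
  · rcases hg i with h | h <;> rcases hg j with h' | h'
    · exact h'.2 _ (hgS i) (h.1.trans hij)
    · have := (h' _ (hgS i)).1
      omega
    · exact (h _ (hgS j)).2
    · exact (h _ (hgS j)).2

/-! ### Factorization at a block of the second pair -/

section TwoLevel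

variable {C : Type*} [Semiring C] [Algebra ℂ C] {Φ Ψ : C →ₗ[ℂ] ℂ}

theorem word_mem {R : Subalgebra ℂ C} {n : ℕ} {c : Fin n → C} (hc : ∀ j, c j ∈ R) :
    word c ∈ R := by
  refine Subalgebra.list_prod_mem _ fun x hx => ?_
  obtain ⟨j, rfl⟩ := (List.mem_ofFn' _ _).1 hx
  exact hc j

theorem mask_mem {R : Subalgebra ℂ C} {n : ℕ} {c : Fin n → C} {S : Finset (Fin n)}
    (hc : ∀ j ∈ S, c j ∈ R) (j : Fin n) : mask c S j ∈ R := by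
  by_cases hj : j ∈ S
  · simpa [mask, hj] using hc j hj
  · simp [mask, hj]

theorem map_word_eq_prod {R : Subalgebra ℂ C} (hone : Ψ 1 = 1)
    (hmul : ∀ x ∈ R, ∀ y ∈ R, Ψ (x * y) = Ψ x * Ψ y) {n : ℕ} {c : Fin n → C}
    (hc : ∀ j, c j ∈ R) : Ψ (word c) = ∏ j, Ψ (c j) := by
  have h : ∀ l : List (Fin n), Ψ (l.map c).prod = (l.map fun j => Ψ (c j)).prod ∧
      (l.map c).prod ∈ R := by
    intro l
    induction l with
    | nil => simp [hone]
    | cons j l ih =>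
      simp only [List.map_cons, List.prod_cons]
      exact ⟨by rw [hmul _ (hc j) _ ih.2, ih.1], mul_mem (hc j) ih.2⟩
  rw [word, List.ofFn_eq_map, (h _).1, ← List.ofFn_eq_map, List.prod_ofFn]

variable {B : Fin 2 → Side → Subalgebra ℂ C} {R : Fin 2 → Subalgebra ℂ C} {n : ℕ}
  {χ : Fin n → Side} {ω : Fin n → Fin 2} {S U V : Finset (Fin n)} {a : Fin n → C}

/-- Here and in `map_word_eq_zero` and `map_word_eq_mul`, `R k` is an algebra that contains both
faces of the `k`-th pair, `Ψ` is a homomorphism on `R 0` and vanishes on the entries from the first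
pair, and `Φ = Ψ` on `R 1`. If all blocks of the second pair are `Ψ`-centred and there is one, then
`Φ` vanishes on the word: the positions outside `S` carry units and are absorbed into the blocks of
their neighbours in `S`, so that the definition of conditional bi-freeness applies. -/
theorem map_word_eq_zero_of_centred (hcb : IsCBiFree Φ Ψ B) (hle : ∀ k ε, B k ε ≤ R k)
    (hone : Ψ 1 = 1) (hmul : ∀ x ∈ R 0, ∀ y ∈ R 0, Ψ (x * y) = Ψ x * Ψ y)
    (heq : ∀ x ∈ R 1, Φ x = Ψ x) (ha : ∀ j ∈ S, a j ∈ B (ω j) (χ j))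
    (ha0 : ∀ j ∈ S, ω j = 0 → Ψ (a j) = 0)
    (hcen : ∀ i ∈ S, ω i = 1 → Ψ (word (mask a (blockIn (chiRank χ) ω S i))) = 0)
    {u : Fin n} (hu : u ∈ S) (hωu : ω u = 1) : Φ (word (mask a S)) = 0 := by
  have hρ := chiRank_injective χ
  obtain ⟨g, hgS, hgid, hgmono⟩ := exists_monotone_retraction (chiRank χ) hρ ⟨u, hu⟩
  have hblock : ∀ i, blockOf χ (fun j => ω (g j)) i ∩ S = blockIn (chiRank χ) ω S (g i) := by
    intro i
    ext j
    rw [Finset.mem_inter, mem_blockOf, mem_blockIn, and_comm]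
    refine and_congr_right fun hj => ⟨fun h x hx hxj => ?_, fun h x hxj => ?_⟩
    · by_cases hxi : chiRank χ x ∈ Set.uIcc (chiRank χ i) (chiRank χ j)
      · simpa only [hgid x hx] using h x hxi
      · -- here `x` lies between `i` and `g i`, so it is `g i`
        have hx' : x = g i := by
          apply hρ
          have h1 := hgmono x i
          have h2 := hgmono i x
          rw [hgid x hx] at h1 h2
          have h3 := hgmono x (g i)
          have h4 := hgmono (g i) x
          rw [hgid x hx, hgid _ (hgS i)] at h3 h4
          rw [Set.mem_uIcc] at *
          omega
        rw [hx']
    · refine h (g x) (hgS x) ?_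
      have h1 := hgmono i x
      have h2 := hgmono x i
      have h3 := hgmono j x
      have h4 := hgmono x j
      rw [hgid j hj] at h3 h4
      rw [Set.mem_uIcc] at *
      omega
  have hsub : ∀ i, subword (mask a S) (blockOf χ (fun j => ω (g j)) i) =
      word (mask a (blockIn (chiRank χ) ω S (g i))) := by
    intro i
    rw [← word_mask, mask_mask, hblock]
  have hzero : ∀ i, Ψ (subword (mask a S) (blockOf χ (fun j => ω (g j)) i)) = 0 := by
    intro i
    rw [hsub]
    have hgi := hgS i
    by_cases h1 : ω (g i) = 1
    · exact hcen _ hgi h1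
    · have h0 : ω (g i) = 0 := by omega
      rw [map_word_eq_prod hone hmul (R := R 0)]
      · refine Finset.prod_eq_zero (Finset.mem_univ (g i)) ?_
        rw [mask, if_pos (self_mem_blockIn hρ hgi)]
        exact ha0 _ hgi h0
      · refine mask_mem fun j hj => ?_
        have hjS := blockIn_subset hj
        have := hle _ _ (ha j hjS)
        rwa [apply_eq_of_mem_blockIn hj, h0] at this
  -- the word is viewed as one with indices `ω ∘ g`, the unit entries being elements of any face
  have hΦ := (hcb n χ (fun j => ω (g j)) (mask a S) (by have := u.2; omega)
    (fun j => by
      by_cases hj : j ∈ S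
      · simpa only [mask, if_pos hj, hgid j hj] using ha j hj
      · simpa only [mask, if_neg hj] using one_mem _)
    (fun V hV => by
      obtain ⟨i, -, rfl⟩ := Finset.mem_image.1 hV
      exact hzero i)).2
  rw [hΦ]
  refine Finset.prod_eq_zero (Finset.mem_image_of_mem _ (Finset.mem_univ u)) ?_
  rw [heq, hzero]
  rw [hsub, hgid u hu]
  refine word_mem (mask_mem fun j hj => ?_)
  have := hle _ _ (ha j (blockIn_subset hj))
  rwa [apply_eq_of_mem_blockIn hj, hωu] at this

/-- If the `Φ`-moment over `S` vanishes for every choice of the entries in `U ⊆ S` for which the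
`Ψ`-moment over `U` does, then the entries in `U` split off: the two moments are proportional as
multilinear forms in these entries, and unit entries give the factor. -/
theorem map_word_eq_mul_of_zero_imp_zero (hone : Ψ 1 = 1) (hUS : U ⊆ S)
    (N : Fin n → Submodule ℂ C) (h1 : ∀ j, 1 ∈ N j) (ha : ∀ j ∈ U, a j ∈ N j)
    (h : ∀ b : Fin n → C, (∀ j ∈ U, b j ∈ N j) → (∀ j ∉ U, b j = a j) →
      Ψ (word (mask b U)) = 0 → Φ (word (mask b S)) = 0) :
    Φ (word (mask a S)) = Ψ (word (mask a U)) * Φ (word (mask a (S \ U))) := by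
  obtain ⟨c, hc⟩ := exists_eq_mul_of_zero_imp_zero N (fun b => Φ (word (mask b S)))
    (fun b => Ψ (word (mask b U))) U (fun i hi => word_mask_update Φ (hUS hi))
    (fun i hi => word_mask_update Ψ hi) a h
  have he := hc (mask a Uᶜ) (fun j hj => by simpa [mask, hj] using h1 j)
    (fun j hj => by simp [mask, hj])
  rw [mask_mask, mask_mask, Finset.inter_compl, word_mask_empty, hone, mul_one,
    ← Finset.sdiff_eq_inter_compl] at he
  rw [hc a ha fun _ _ => rfl, he, mul_comm]

/-- One `Ψ`-centred block of the second pair suffices for `Φ` to vanish. A block `X` that is not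
centred splits off by `map_word_eq_mul_of_zero_imp_zero`, as the word vanishes by induction for
all centred choices of the entries in `X`; what remains has fewer blocks that are not centred. -/
theorem map_word_eq_zero (hcb : IsCBiFree Φ Ψ B) (hle : ∀ k ε, B k ε ≤ R k)
    (hone : Ψ 1 = 1) (hmul : ∀ x ∈ R 0, ∀ y ∈ R 0, Ψ (x * y) = Ψ x * Ψ y)
    (heq : ∀ x ∈ R 1, Φ x = Ψ x) (ha : ∀ j ∈ S, a j ∈ B (ω j) (χ j))
    (ha0 : ∀ j ∈ S, ω j = 0 → Ψ (a j) = 0) {u : Fin n} (hu : u ∈ S) (hωu : ω u = 1)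
    (hcen : Ψ (word (mask a (blockIn (chiRank χ) ω S u))) = 0) : Φ (word (mask a S)) = 0 := by
  classical
  have hρ := chiRank_injective χ
  -- induction on the number of positions in blocks of the second pair that are not centred
  induction hN : (S.filter fun i => ω i = 1 ∧
    Ψ (word (mask a (blockIn (chiRank χ) ω S i))) ≠ 0).card using Nat.strong_induction_on
    generalizing S a with
  | _ N ih =>
  by_cases hall : ∀ i ∈ S, ω i = 1 → Ψ (word (mask a (blockIn (chiRank χ) ω S i))) = 0
  · exact map_word_eq_zero_of_centred hcb hle hone hmul heq ha ha0 hall hu hωu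
  push Not at hall
  obtain ⟨i, hi, hωi, hne⟩ := hall
  have hpeak : ∀ {j}, ω j = 1 → IsPeak (chiRank χ) ω S (blockIn (chiRank χ) ω S j) :=
    fun hj => isPeak_blockIn fun k _ => by omega
  set X := blockIn (chiRank χ) ω S i with hX
  have hiX : i ∈ X := self_mem_blockIn hρ hi
  -- the other blocks of the second pair are disjoint from `X`
  have hdisj : ∀ j ∈ S, ω j = 1 → j ∉ X → Disjoint X (blockIn (chiRank χ) ω S j) := by
    intro j hj hωj hjX
    rw [Finset.disjoint_left]
    intro k hkX hk
    apply hjX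
    have hXk : X = blockIn (chiRank χ) ω S k := (hpeak hωi).eq_blockIn hkX
    rw [hXk, ← (hpeak hωj).eq_blockIn hk]
    exact self_mem_blockIn hρ hj
  have hX' : ∀ j ∈ X, blockIn (chiRank χ) ω S j = X := fun j hj =>
    ((hpeak hωi).eq_blockIn hj).symm
  have huX : u ∉ X := fun h => hne (by rw [← hX' u h]; exact hcen)
  have hsplit := map_word_eq_mul_of_zero_imp_zero (Φ := Φ) (a := a) hone
    (blockIn_subset : X ⊆ S)
    (fun j => Subalgebra.toSubmodule (B (ω j) (χ j))) (fun j => one_mem (B (ω j) (χ j)))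
    (fun j hj => ha j (blockIn_subset hj)) (fun b hb hba hb0 => by
      have hbB : ∀ j ∈ S, ω j = 1 → j ∉ X → word (mask b (blockIn (chiRank χ) ω S j)) =
          word (mask a (blockIn (chiRank χ) ω S j)) := by
        intro j hj hωj hjX
        rw [mask_congr fun k hk => hba k fun hkX =>
          Finset.disjoint_left.1 (hdisj j hj hωj hjX) hkX hk]
      refine ih _ ?_ (S := S) (a := b) (fun j hj => ?_) (fun j hj hj0 => ?_) hu ?_ rfl
      · rw [← hN]
        refine Finset.card_lt_card ((Finset.ssubset_iff_of_subset fun j hj => ?_).2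
          ⟨i, by simp [hi, hωi, hne, ← hX], ?_⟩)
        · rw [Finset.mem_filter] at hj ⊢
          refine ⟨hj.1, hj.2.1, ?_⟩
          have hjX : j ∉ X := fun h => hj.2.2 (by rw [hX' j h]; exact hb0)
          rw [← hbB j hj.1 hj.2.1 hjX]
          exact hj.2.2
        · simp only [Finset.mem_filter, not_and, not_not]
          exact fun _ _ => hb0
      · by_cases hjX : j ∈ X
        · exact hb j hjX
        · rw [hba j hjX]; exact ha j hj
      · have hjX : j ∉ X := fun h => by
          have := apply_eq_of_mem_blockIn h
          omega
        rw [hba j hjX]; exact ha0 j hj hj0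
      · rw [hbB u hu hωu huX]; exact hcen)
  have hblock : ∀ j ∈ S \ X, ω j = 1 →
      blockIn (chiRank χ) ω (S \ X) j = blockIn (chiRank χ) ω S j := by
    intro j hj hωj
    rw [Finset.mem_sdiff] at hj
    exact (((hpeak hωi).sdiff (hpeak hωj) (hdisj j hj.1 hωj hj.2)).eq_blockIn
      (self_mem_blockIn hρ hj.1)).symm
  have huS : u ∈ S \ X := Finset.mem_sdiff.2 ⟨hu, huX⟩
  have hzero : Φ (word (mask a (S \ X))) = 0 := by
    refine ih _ ?_ (fun j hj => ha j (Finset.mem_sdiff.1 hj).1)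
      (fun j hj => ha0 j (Finset.mem_sdiff.1 hj).1) huS (by rw [hblock u huS hωu]; exact hcen) rfl
    rw [← hN]
    refine Finset.card_lt_card ((Finset.ssubset_iff_of_subset fun j hj => ?_).2
      ⟨i, by simp [hi, hωi, hne, ← hX], by simp [hiX]⟩)
    rw [Finset.mem_filter] at hj ⊢
    rw [hblock j hj.1 hj.2.1] at hj
    exact ⟨(Finset.mem_sdiff.1 hj.1).1, hj.2⟩
  rw [hsplit, hzero, mul_zero]

/-- In a conditionally bi-free product of the kind that defines the bi-monotonic product, the
blocks of the second pair split off. -/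
theorem map_word_eq_mul (hcb : IsCBiFree Φ Ψ B) (hle : ∀ k ε, B k ε ≤ R k)
    (hone : Ψ 1 = 1) (hmul : ∀ x ∈ R 0, ∀ y ∈ R 0, Ψ (x * y) = Ψ x * Ψ y)
    (heq : ∀ x ∈ R 1, Φ x = Ψ x) (ha : ∀ j ∈ S, a j ∈ B (ω j) (χ j))
    (ha0 : ∀ j ∈ S, ω j = 0 → Ψ (a j) = 0) (hV : IsPeak (chiRank χ) ω S V)
    (hωV : ∀ j ∈ V, ω j = 1) :
    Φ (word (mask a S)) = Φ (word (mask a V)) * Φ (word (mask a (S \ V))) := by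
  have hΦ : Φ (word (mask a V)) = Ψ (word (mask a V)) := by
    refine heq _ (word_mem (mask_mem fun j hj => ?_))
    have := hle _ _ (ha j (hV.subset hj))
    rwa [hωV j hj] at this
  rw [hΦ]
  rcases V.eq_empty_or_nonempty with rfl | ⟨u, hu⟩
  · rw [word_mask_empty, hone, one_mul, Finset.sdiff_empty]
  refine map_word_eq_mul_of_zero_imp_zero hone hV.subset
    (fun j => Subalgebra.toSubmodule (B (ω j) (χ j))) (fun j => one_mem (B (ω j) (χ j)))
    (fun j hj => ha j (hV.subset hj)) fun b hb hba hb0 => ?_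
  refine map_word_eq_zero hcb hle hone hmul heq (u := u) (fun j hj => ?_) (fun j hj hj0 => ?_)
    (hV.subset hu) (hωV u hu) (by rw [← hV.eq_blockIn hu]; exact hb0)
  · by_cases hjV : j ∈ V
    · exact hb j hjV
    · rw [hba j hjV]; exact ha j hj
  · have hjV : j ∉ V := fun h => by
      have := hωV j h
      omega
    rw [hba j hjV]; exact ha0 j hj hj0

end TwoLevel

/-! ### From the bi-monotonic product to moments -/

theorem free.induction {I : Type} [DecidableEq I] (A : I → NUAlg.{u}) {P : free A → Prop}
    (of : ∀ i a, P (free.of A i a)) (zero : P 0) (add : ∀ x y, P x → P y → P (x + y))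
    (mul : ∀ x y, P x → P y → P (x * y)) (smul : ∀ (c : ℂ) x, P x → P (c • x)) (x : free A) :
    P x := by
  obtain ⟨x, hx⟩ := x
  induction hx using NonUnitalAlgebra.adjoin_induction with
  | mem x hx =>
    obtain ⟨i, a, rfl⟩ := Set.mem_iUnion.1 hx
    exact of i a
  | add x y hx hy h1 h2 => exact add ⟨x, hx⟩ ⟨y, hy⟩ h1 h2
  | zero => exact zero
  | mul x y hx hy h1 h2 => exact mul ⟨x, hx⟩ ⟨y, hy⟩ h1 h2
  | smul c x hx h => exact smul c ⟨x, hx⟩ h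

theorem unitExt_inr {D : Type*} [NonUnitalSemiring D] [Module ℂ D]
    (φ : D →ₗ[ℂ] ℂ) (x : D) : unitExt φ (Unitization.inr x) = φ x := by
  simp [unitExt]

theorem unitExt_one {D : Type*} [NonUnitalSemiring D] [Module ℂ D]
    (φ : D →ₗ[ℂ] ℂ) : unitExt φ 1 = 1 := by
  simp [unitExt]

section Transfer

variable {D : Type v} [NonUnitalSemiring D] [Module ℂ D] [IsScalarTower ℂ D D]
  [SMulCommClass ℂ D D]

/-- `regroup` is onto, and it is compatible with the homomorphisms to an algebra `D` in which all
faces are realized. -/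
theorem exists_regroup_eq (F : Fin 2 → Side → NUAlg.{u}) (h : ∀ k ε, F k ε →ₙₐ[ℂ] D)
    (x : free fun k => free (F k)) :
    ∃ y : free (joinFaces F), regroup F y = x ∧
      free.lift (joinFaces F) (fun ε => free.lift (fun k => F k ε) fun k => h k ε) y =
        free.lift (fun k => free (F k)) (fun k => free.lift (F k) (h k)) x := by
  induction x using free.induction with
  | of k z =>
    induction z using free.induction with
    | of ε z =>
      refine ⟨free.of (joinFaces F) ε (free.of (fun k => F k ε) k z), ?_, ?_⟩
      · exact (free.lift_of (joinFaces F) _ ε _).trans (free.lift_of (fun k => F k ε) _ k z)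
      · refine (free.lift_of (joinFaces F) _ ε _).trans ?_
        rw [free.lift_of (fun k => free (F k)), free.lift_of (F k)]
        exact free.lift_of (fun k => F k ε) _ k z
    | zero => exact ⟨0, by simp, by simp⟩
    | add x y hx hy =>
      obtain ⟨x', hx, hx'⟩ := hx
      obtain ⟨y', hy, hy'⟩ := hy
      exact ⟨x' + y', by simp [hx, hy], by simp only [map_add, hx', hy']⟩
    | mul x y hx hy =>
      obtain ⟨x', hx, hx'⟩ := hx
      obtain ⟨y', hy, hy'⟩ := hy
      exact ⟨x' * y', by simp [hx, hy], by simp only [map_mul, hx', hy']⟩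
    | smul c x hx =>
      obtain ⟨x', hx, hx'⟩ := hx
      exact ⟨c • x', by simp [hx], by simp only [map_smul, hx']⟩
  | zero => exact ⟨0, by simp, by simp⟩
  | add x y hx hy =>
    obtain ⟨x', hx, hx'⟩ := hx
    obtain ⟨y', hy, hy'⟩ := hy
    exact ⟨x' + y', by simp [hx, hy], by simp only [map_add, hx', hy']⟩
  | mul x y hx hy =>
    obtain ⟨x', hx, hx'⟩ := hx
    obtain ⟨y', hy, hy'⟩ := hy
    exact ⟨x' * y', by simp [hx, hy], by simp only [map_mul, hx', hy']⟩
  | smul c x hx =>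
    obtain ⟨x', hx, hx'⟩ := hx
    exact ⟨c • x', by simp [hx], by simp only [map_smul, hx']⟩

theorem inr_lift_snd {I : Type} [DecidableEq I] (A : I → NUAlg.{u}) (f : ∀ i, A i →ₙₐ[ℂ] D)
    (x : free A) : (Unitization.inr (free.lift A f x) : Unitization ℂ D) =
      UnitalFree.lift A f x.1 := by
  refine Unitization.ext ?_ ?_
  · rw [UnitalFree.fst_lift A f x.1 x.2, Unitization.fst_inr]
  · rfl

theorem map_word {C E : Type*} [Semiring C] [Semiring E] [Algebra ℂ C] [Algebra ℂ E]
    (π : C →ₐ[ℂ] E) {n : ℕ} (a : Fin n → C) (S : Finset (Fin n)) :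
    π (word (mask a S)) = word (mask (fun j => π (a j)) S) := by
  unfold word
  rw [map_list_prod, List.map_ofFn]
  congr 2
  funext j
  by_cases hj : j ∈ S <;> simp [mask, hj]

theorem word_mask_mem {C : Type*} [Semiring C] [Algebra ℂ C] (N : NonUnitalSubalgebra ℂ C)
    {n : ℕ} (a : Fin n → C) (S : Finset (Fin n)) (ha : ∀ j ∈ S, a j ∈ N) :
    word (mask a S) = 1 ∨ word (mask a S) ∈ N := by
  have h : ∀ l : List (Fin n), (l.map (mask a S)).prod = 1 ∨ (l.map (mask a S)).prod ∈ N := by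
    intro l
    induction l with
    | nil => simp
    | cons j l ih =>
      rw [List.map_cons, List.prod_cons]
      by_cases hj : j ∈ S
      · rw [mask, if_pos hj]
        rcases ih with ih | ih
        · right; rw [ih, mul_one]; exact ha j hj
        · right; exact mul_mem (ha j hj) ih
      · rwa [mask, if_neg hj, one_mul]
  rw [word, List.ofFn_eq_map]
  exact h _

/-- `map_word_eq_mul` for the moments of an algebra `D` whose joint distribution is a bi-monotonic
product. On the free product, `Φ` agrees with `φ̃` composed with the homomorphism to the
unitization of `D`. -/
theorem unitExt_word_eq_mul (F : Fin 2 → Side → NUAlg.{u}) (h : ∀ k ε, F k ε →ₙₐ[ℂ] D)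
    (φ : D →ₗ[ℂ] ℂ) {φ₁ : free (F 0) →ₗ[ℂ] ℂ} {φ₂ : free (F 1) →ₗ[ℂ] ℂ}
    {Θ : free (fun k => free (F k)) →ₗ[ℂ] ℂ} (hprod : IsBiMonotonicProduct F φ₁ φ₂ Θ)
    (hΘ : ∀ x, φ (free.lift (joinFaces F)
      (fun ε => free.lift (fun k => F k ε) fun k => h k ε) x) = Θ (regroup F x))
    {n : ℕ} {χ : Fin n → Side} {ω : Fin n → Fin 2} (y : ∀ j, F (ω j) (χ j))
    {S V : Finset (Fin n)} (hV : IsPeak (chiRank χ) ω S V) (hωV : ∀ j ∈ V, ω j = 1) :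
    let w : Finset (Fin n) → ℂ := fun T => unitExt φ
      (word (mask (fun j => (Unitization.inr (h (ω j) (χ j) (y j)) : Unitization ℂ D)) T))
    w S = w V * w (S \ V) := by
  intro w
  obtain ⟨Φ, Ψ, hcf, hΦ⟩ := hprod
  let ι := fun k => LinearAlgebra.FreeProduct.ι ℂ (fun k => Unitization ℂ (free (F k))) k
  let π := UnitalFree.lift (fun k => free (F k)) (fun k => free.lift (F k) (h k))
  let a : Fin n → UnitalFree (fun k => free (F k)) := fun j =>
    UnitalFree.of (fun k => free (F k)) (ω j) (free.of (F (ω j)) (χ j) (y j))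
  have haι : ∀ j, a j = ι (ω j) (Unitization.inr (free.of (F (ω j)) (χ j) (y j))) := fun _ => rfl
  have hπa : ∀ j, π (a j) = Unitization.inr (h (ω j) (χ j) (y j)) := fun j => by
    simp only [π, a, UnitalFree.lift_of, free.lift_of]
  have hΦ1 : Φ 1 = 1 := by
    have := hcf.restrict_left 0 1
    rw [map_one] at this
    rw [this]; exact unitExt_one _
  have hΨ1 : Ψ 1 = 1 := by
    have := hcf.restrict_right 1 1
    rw [map_one] at this
    rw [this]; exact unitExt_one _
  have hΦπ : ∀ x ∈ freeSub (fun k => free (F k)), Φ x = unitExt φ (π x) := by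
    intro x hx
    obtain ⟨z, hz, hz'⟩ := exists_regroup_eq F h ⟨x, hx⟩
    have h1 := hΘ z
    rw [hz, hz', hΦ] at h1
    have h2 := unitExt_inr φ
      (free.lift (fun k => free (F k)) (fun k => free.lift (F k) (h k)) ⟨x, hx⟩)
    exact h1.symm.trans (h2.symm.trans (congrArg (unitExt φ) (inr_lift_snd _ _ _)))
  have hw : ∀ T, Φ (word (mask a T)) = w T := by
    intro T
    have hT : w T = unitExt φ (π (word (mask a T))) := by
      simp only [w, map_word, hπa]
    rw [hT]
    rcases word_mask_mem (freeSub fun k => free (F k)) a T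
      (fun j _ => (free.of (fun k => free (F k)) (ω j) (free.of (F (ω j)) (χ j) (y j))).2)
      with h1 | h1
    · rw [h1, map_one π, unitExt_one, hΦ1]
    · exact hΦπ _ h1
  rw [← hw, ← hw, ← hw]
  refine map_word_eq_mul hcf.cbifree (R := fun k => (ι k).range)
    (fun k ε x hx => ?_) hΨ1 ?_ ?_ (fun j _ => ?_) (fun j _ hj => ?_) hV hωV
  · obtain ⟨z, -, rfl⟩ := hx
    exact ⟨z, rfl⟩
  · rintro _ ⟨x, rfl⟩ _ ⟨z, rfl⟩
    have hr := hcf.restrict_right 0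
    change Ψ (ι 0 x * ι 0 z) = Ψ (ι 0 x) * Ψ (ι 0 z)
    rw [← map_mul]
    erw [hr, hr, hr]
    exact map_mul (Unitization.fstHom ℂ (free (F 0))) x z
  · rintro _ ⟨x, rfl⟩
    exact (hcf.restrict_left 1 x).trans (hcf.restrict_right 1 x).symm
  · exact ⟨_, ⟨Unitization.inr (y j), by simp⟩, rfl⟩
  · rw [haι]
    have hr : ∀ k : Fin 2, k = 0 → ∀ x : free (F k), Ψ (ι k (Unitization.inr x)) = 0 := by
      rintro _ rfl x
      exact (hcf.restrict_right 0 _).trans (Unitization.fst_inr ℂ x)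
    exact hr _ hj _

theorem iterHom_succ (A : ℕ → Side → NUAlg.{u}) (f : ∀ k ε, A k ε →ₙₐ[ℂ] D) (m : ℕ) (ε : Side) :
    iterHom A f (m + 1) ε =
      free.lift (fun k => (![iterFaces A m, A (m + 1)] : Fin 2 → Side → NUAlg.{u}) k ε)
        fun | 0 => iterHom A f m ε | 1 => f (m + 1) ε := rfl

/-- The image of the `m`-th iterated face contains the images of the faces `0, …, m`. -/
theorem exists_iterHom_eq (A : ℕ → Side → NUAlg.{u}) (f : ∀ k ε, A k ε →ₙₐ[ℂ] D) {m i : ℕ}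
    (hi : i ≤ m) (ε : Side) (x : A i ε) : ∃ y, iterHom A f m ε y = f i ε x := by
  induction m with
  | zero =>
    obtain rfl : i = 0 := by omega
    exact ⟨x, rfl⟩
  | succ m ih =>
    rw [iterHom_succ]
    rcases Nat.lt_or_ge m i with h | h
    · obtain rfl : i = m + 1 := by omega
      exact ⟨_, free.lift_of (fun k => (![iterFaces A m, A (m + 1)] : Fin 2 → Side → NUAlg.{u}) k ε)
        _ 1 x⟩
    · obtain ⟨y, hy⟩ := ih h
      exact ⟨_, (free.lift_of
        (fun k => (![iterFaces A m, A (m + 1)] : Fin 2 → Side → NUAlg.{u}) k ε) _ 0 y).trans hy⟩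

end Transfer

section Moments

variable {K : Type*} [LinearOrder K] {A : Type u} [NonUnitalRing A] [Module ℂ A]
  [IsScalarTower ℂ A A] [SMulCommClass ℂ A A] {φ : A →ₗ[ℂ] ℂ}
  {B : K → Side → NonUnitalSubalgebra ℂ A} {n : ℕ} {χ : Fin n → Side} {ω : Fin n → K}
  {a : Fin n → A} {S V : Finset (Fin n)}

theorem moment_eq_unitExt_word (φ : A →ₗ[ℂ] ℂ) (a : Fin n → A) (S : Finset (Fin n)) :
    moment φ a S =
      unitExt φ (word (mask (fun j => (Unitization.inr (a j) : Unitization ℂ A)) S)) := by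
  rw [word_mask]; rfl

theorem moment_empty (φ : A →ₗ[ℂ] ℂ) (a : Fin n → A) : moment φ a ∅ = 1 := by
  rw [moment_eq_unitExt_word, word_mask_empty, unitExt_one]

/-- A finite set of indices below `M` is listed by a strictly increasing sequence ending with
`M`. -/
theorem exists_strictMonoOn_enum {T : Finset K} (hT : T.Nonempty) {M : K} (hM : ∀ t ∈ T, t < M) :
    ∃ (m : ℕ) (k : ℕ → K), StrictMonoOn k (Set.Iic (m + 1)) ∧ k (m + 1) = M ∧
      ∀ t ∈ T, ∃ i ≤ m, k i = t := by
  obtain ⟨m, hm⟩ : ∃ m, T.card = m + 1 := ⟨T.card - 1, by have := hT.card_pos; omega⟩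
  let e := T.orderIsoOfFin hm
  refine ⟨m, fun i => if h : i < m + 1 then e ⟨i, h⟩ else M, ?_, by simp, fun t ht => ?_⟩
  · intro i hi j hj hij
    have hj' : j ≤ m + 1 := hj
    have hi' : i < m + 1 := by omega
    by_cases hjm : j < m + 1
    · simp only [hi', hjm, dif_pos]
      exact_mod_cast e.strictMono (a := ⟨i, hi'⟩) (b := ⟨j, hjm⟩) hij
    · simp only [hi', hjm, dif_pos, dif_neg, not_false_eq_true]
      exact hM _ (e ⟨i, hi'⟩).2
  · have h := (e.symm ⟨t, ht⟩).2
    refine ⟨(e.symm ⟨t, ht⟩), by omega, ?_⟩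
    simp [h]

/-- The factorization of moments of an iterated bi-monotonic product at a block of the last
pair: only the outermost product matters. -/
theorem moment_eq_mul_of_isIteratedProduct {E : ℕ → Side → NUAlg.{u}}
    {f : ∀ i ε, E i ε →ₙₐ[ℂ] A} {ψ : ∀ i, free (E i) →ₗ[ℂ] ℂ} {m : ℕ}
    (hE : IsIteratedProduct E ψ (m + 1) (jointDist φ (iterFaces E (m + 1)) (iterHom E f (m + 1))))
    {ω' : Fin n → Fin 2}
    (h0 : ∀ j ∈ S, ω' j = 0 → ∃ i ≤ m, ∃ x, f i (χ j) x = a j)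
    (h1 : ∀ j ∈ S, ω' j = 1 → ∃ x, f (m + 1) (χ j) x = a j)
    (hV : IsPeak (chiRank χ) ω' S V) (hωV : ∀ j ∈ V, ω' j = 1) :
    moment φ a S = moment φ a V * moment φ a (S \ V) := by
  obtain ⟨φ₁, Θ, -, hprod, hΘ⟩ := hE
  let F : Fin 2 → Side → NUAlg.{u} := ![iterFaces E m, E (m + 1)]
  let h : ∀ i ε, F i ε →ₙₐ[ℂ] A := fun
    | 0, ε => iterHom E f m ε
    | 1, ε => f (m + 1) ε
  have hy : ∀ j, ∃ y : F (ω' j) (χ j), j ∈ S → h (ω' j) (χ j) y = a j := by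
    intro j
    by_cases hj : j ∈ S
    · have h0j := h0 j hj
      have h1j := h1 j hj
      revert h0j h1j
      generalize ω' j = t
      intro h0j h1j
      match t with
      | 0 =>
        obtain ⟨i, hi, x, hx⟩ := h0j rfl
        obtain ⟨y, hy⟩ := exists_iterHom_eq E f hi (χ j) x
        exact ⟨y, fun _ => hy.trans hx⟩
      | 1 =>
        obtain ⟨x, hx⟩ := h1j rfl
        exact ⟨x, fun _ => hx⟩
    · exact ⟨0, fun h => absurd h hj⟩
  choose y hy using hy
  -- the homomorphisms on the joined faces are those of the last step of the recursion
  have hΘ' : ∀ x, φ (free.lift (joinFaces F)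
      (fun ε => free.lift (fun k => F k ε) fun k => h k ε) x) = Θ (regroup F x) := by
    intro x
    rw [← hΘ x]
    have hH : (fun ε => free.lift (fun k => F k ε) fun k => h k ε) = iterHom E f (m + 1) := by
      funext ε
      rw [iterHom_succ]
      congr 1
      funext i
      match i with
      | 0 => rfl
      | 1 => rfl
    exact congrArg (fun H => φ (free.lift (joinFaces F) H x)) hH
  have key := unitExt_word_eq_mul F h φ hprod hΘ' y hV hωV
  have hmask : ∀ T ⊆ S, mask (fun j => (Unitization.inr (h (ω' j) (χ j) (y j)) :
      Unitization ℂ A)) T = mask (fun j => Unitization.inr (a j)) T :=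
    fun T hTS => mask_congr fun j hj => by rw [hy j (hTS hj)]
  simp only [hmask S subset_rfl, hmask V hV.subset, hmask (S \ V) Finset.sdiff_subset] at key
  simpa only [moment_eq_unitExt_word] using key

/-- Factorization at a block with the largest index that occurs in `S`. -/
theorem moment_eq_mul_of_isPeak_of_le (hB : IsBiMonotonicallyIndependent φ B)
    (ha : ∀ j, a j ∈ B (ω j) (χ j)) (hV : IsPeak (chiRank χ) ω S V) {M : K}
    (hM : ∀ j ∈ S, ω j ≤ M) (hVM : ∀ j ∈ V, ω j = M) :
    moment φ a S = moment φ a V * moment φ a (S \ V) := by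
  classical
  rcases V.eq_empty_or_nonempty with rfl | ⟨v, hv⟩
  · rw [moment_empty, one_mul, Finset.sdiff_empty]
  by_cases hT : ((S.image ω).filter (· < M)).Nonempty
  swap
  -- if no other index occurs, then `V` is all of `S`
  · have hSV : S = V := by
      refine Finset.Subset.antisymm (fun j hj => ?_) hV.subset
      by_contra hjV
      have hlow : ∀ x ∈ S, ¬ ω x < M := fun x hx hlt =>
        hT ⟨ω x, Finset.mem_filter.2 ⟨Finset.mem_image_of_mem _ hx, hlt⟩⟩
      obtain ⟨x, hx, -, hlt⟩ := hV.lower v hv j hj hjV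
        (by rw [hVM v hv]; exact not_lt.1 (hlow j hj))
      exact hlow x hx (by rwa [hVM v hv] at hlt)
    rw [hSV, Finset.sdiff_self, moment_empty, mul_one]
  obtain ⟨m, k, hk, hkM, hkT⟩ := exists_strictMonoOn_enum hT
    (M := M) (fun t ht => (Finset.mem_filter.1 ht).2)
  refine moment_eq_mul_of_isIteratedProduct (hB (m + 1) k hk) (χ := χ)
    (ω' := fun j => if ω j < M then 0 else 1) (fun j hj hj0 => ?_) (fun j hj hj1 => ?_) ?_
    (fun j hj => if_neg (hVM j hj).not_lt)
  · have hlt : ω j < M := by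
      by_contra hlt
      rw [if_neg hlt] at hj0
      exact absurd hj0 (by decide)
    obtain ⟨i, hi, hki⟩ := hkT (ω j) (Finset.mem_filter.2 ⟨Finset.mem_image_of_mem _ hj, hlt⟩)
    exact ⟨i, hi, ⟨a j, hki ▸ ha j⟩, rfl⟩
  · have hlt : ¬ ω j < M := by
      intro hlt
      rw [if_pos hlt] at hj1
      exact absurd hj1 (by decide)
    have hjM : ω j = k (m + 1) := by
      rw [hkM]; exact le_antisymm (hM j hj) (not_lt.1 hlt)
    exact ⟨⟨a j, hjM ▸ ha j⟩, rfl⟩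
  · refine ⟨hV.subset, fun i hi j hj => by simp only [hV.const i hi j hj], hV.convex,
      fun i hi j hj hjV hle => ?_⟩
    have hi1 : ¬ ω i < M := (hVM i hi).not_lt
    have hj1 : ¬ ω j < M := fun hlt => by
      rw [if_neg hi1, if_pos hlt] at hle
      exact absurd hle (by decide)
    obtain ⟨x, hx, hxj, hlt⟩ := hV.lower i hi j hj hjV (by rw [hVM i hi]; exact not_lt.1 hj1)
    refine ⟨x, hx, hxj, ?_⟩
    rw [if_pos (by rwa [hVM i hi] at hlt), if_neg hi1]
    decide

/-- Factorization at an arbitrary peak `V`: blocks with larger indices are themselves peaks, and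
they are removed one by one. -/
theorem moment_eq_mul_of_isPeak (hB : IsBiMonotonicallyIndependent φ B)
    (ha : ∀ j, a j ∈ B (ω j) (χ j)) (hV : IsPeak (chiRank χ) ω S V) :
    moment φ a S = moment φ a V * moment φ a (S \ V) := by
  induction hN : S.card using Nat.strong_induction_on generalizing S with
  | _ N ih =>
  rcases V.eq_empty_or_nonempty with rfl | ⟨v, hv⟩
  · rw [moment_empty, one_mul, Finset.sdiff_empty]
  obtain ⟨i, hi, hmax⟩ := S.exists_max_image ω ⟨v, hV.subset hv⟩
  by_cases hvi : ω v = ω i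
  · exact moment_eq_mul_of_isPeak_of_le hB ha hV hmax
      (fun j hj => (hV.const j hj v hv).trans hvi)
  have hU : IsPeak (chiRank χ) ω S (blockIn (chiRank χ) ω S i) := isPeak_blockIn hmax
  have hUi : ∀ j ∈ blockIn (chiRank χ) ω S i, ω j = ω i := fun j hj => apply_eq_of_mem_blockIn hj
  have hiU : i ∈ blockIn (chiRank χ) ω S i := self_mem_blockIn (chiRank_injective χ) hi
  set U := blockIn (chiRank χ) ω S i
  have hd : Disjoint U V := Finset.disjoint_left.2 fun j hjU hjV =>
    hvi ((hV.const v hv j hjV).trans (hUi j hjU))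
  have h1 := moment_eq_mul_of_isPeak_of_le hB ha hU hmax hUi
  have h2 := moment_eq_mul_of_isPeak_of_le hB ha (hV.sdiff hU hd.symm)
    (fun j hj => hmax j (Finset.mem_sdiff.1 hj).1) hUi
  have h3 := ih _ (hN ▸ Finset.card_lt_card (Finset.sdiff_ssubset hU.subset ⟨i, hiU⟩))
    (hU.sdiff hV hd) rfl
  rw [h1, h2, h3, sdiff_right_comm]
  ring

end Moments

/-! ### Peaks of `π_{χ,ω}` and of words in one face -/

theorem blockOf_eq_blockIn {κ : Type*} {n : ℕ} (χ : Fin n → Side) (ω : Fin n → κ) (i : Fin n) :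
    blockOf χ ω i = blockIn (chiRank χ) ω Finset.univ i := by
  ext j
  simp [mem_blockOf, mem_blockIn]

theorem IsOrderedBlocks.isPeak {κ : Type*} [LinearOrder κ] {n m : ℕ} {χ : Fin n → Side}
    {ω : Fin n → κ} {V : Fin m → Finset (Fin n)} (hV : IsOrderedBlocks χ ω V) (k : Fin m)
    (hk : ∀ k' : Fin m, (k' : ℕ) + 1 = k ∨ (k' : ℕ) = k + 1 →
      ∀ i ∈ V k, ∀ j ∈ V k', ω j < ω i) :
    IsPeak (chiRank χ) ω Finset.univ (V k) := by
  have hblock : ∀ k', ∃ i, V k' = blockIn (chiRank χ) ω Finset.univ i := by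
    intro k'
    obtain ⟨i, -, hi⟩ := Finset.mem_image.1 ((hV.mem_iff (V k')).2 ⟨k', rfl⟩)
    exact ⟨i, by rw [← hi, blockOf_eq_blockIn]⟩
  have hne : ∀ k', ∃ i, i ∈ V k' := by
    intro k'
    obtain ⟨i, hi⟩ := hblock k'
    exact ⟨i, hi ▸ self_mem_blockIn (chiRank_injective χ) (Finset.mem_univ i)⟩
  have hcover : ∀ j, ∃ k', j ∈ V k' := by
    intro j
    obtain ⟨k', hk'⟩ := (hV.mem_iff (blockOf χ ω j)).1
      (Finset.mem_image_of_mem _ (Finset.mem_univ j))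
    refine ⟨k', ?_⟩
    rw [hk', blockOf_eq_blockIn]
    exact self_mem_blockIn (chiRank_injective χ) (Finset.mem_univ j)
  have hlt : ∀ k₁ k₂ : Fin m, k₁ < k₂ → ∀ i ∈ V k₁, ∀ j ∈ V k₂, chiRank χ i < chiRank χ j :=
    fun k₁ k₂ h i hi j hj => (chiLT_iff χ i j).1 (hV.lt k₁ k₂ h i hi j hj)
  obtain ⟨i₀, hi₀⟩ := hblock k
  refine ⟨Finset.subset_univ _, fun i hi j hj => ?_, fun i hi j hj x hx hxij => ?_,
    fun i hi j _ hjV hle => ?_⟩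
  · rw [hi₀] at hi hj
    exact (apply_eq_of_mem_blockIn hi).trans (apply_eq_of_mem_blockIn hj).symm
  · rw [hi₀] at hi hj ⊢
    exact blockIn_convex hi hj hx hxij
  · obtain ⟨k', hk'⟩ := hcover j
    have hkk : (k' : ℕ) ≠ k := fun h => hjV (by rwa [Fin.ext h] at hk')
    have hn1 : (k' : ℕ) + 1 ≠ k := fun h => (hk k' (Or.inl h) i hi j hk').not_ge hle
    have hn2 : (k' : ℕ) ≠ k + 1 := fun h => (hk k' (Or.inr h) i hi j hk').not_ge hle
    have := k.2
    have := k'.2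
    rcases Nat.lt_or_gt_of_ne hkk with h | h
    · let l : Fin m := ⟨k - 1, by omega⟩
      have hl : (l : ℕ) = k - 1 := rfl
      obtain ⟨x, hx⟩ := hne l
      have h1 := hlt k' l (by rw [Fin.lt_def]; omega) j hk' x hx
      have h2 := hlt l k (by rw [Fin.lt_def]; omega) x hx i hi
      exact ⟨x, Finset.mem_univ x, Set.mem_uIcc.2 (by omega), hk l (by omega) i hi x hx⟩
    · let l : Fin m := ⟨k + 1, by omega⟩
      have hl : (l : ℕ) = k + 1 := rfl
      obtain ⟨x, hx⟩ := hne l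
      have h1 := hlt k l (by rw [Fin.lt_def]; omega) i hi x hx
      have h2 := hlt l k' (by rw [Fin.lt_def]; omega) x hx j hk'
      exact ⟨x, Finset.mem_univ x, Set.mem_uIcc.2 (by omega), hk l (by omega) i hi x hx⟩

theorem isPeak_singleton {ι κ : Type*} [LinearOrder κ] {ρ : ι → ℕ} (hρ : Function.Injective ρ)
    {ω : ι → κ} {S : Finset ι} {p : ι} (hp : p ∈ S)
    (h : ∀ j ∈ S, j ≠ p → ω p ≤ ω j → ∃ x ∈ S, ρ x ∈ Set.uIcc (ρ p) (ρ j) ∧ ω x < ω p) :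
    IsPeak ρ ω S {p} := by
  refine ⟨by simpa using hp, fun i hi j hj => ?_, fun i hi j hj x hx hxij => ?_,
    fun i hi j hj hjn hle => ?_⟩
  · rw [Finset.mem_singleton.1 hi, Finset.mem_singleton.1 hj]
  · rw [Finset.mem_singleton.1 hi, Finset.mem_singleton.1 hj, Set.uIcc_self] at hxij
    exact Finset.mem_singleton.2 (hρ hxij)
  · obtain rfl := Finset.mem_singleton.1 hi
    exact h j hj (fun h => hjn (Finset.mem_singleton.2 h)) hle

/-- In a word from one face, `≺_χ` is the usual order of the positions or its reverse. -/
theorem isPeak_singleton_of_neighbours {κ : Type*} [LinearOrder κ] {n : ℕ} {ω : Fin n → κ}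
    (ε : Side) {p : Fin n}
    (hp : ∀ q : Fin n, (q : ℕ) + 1 = p ∨ (q : ℕ) = p + 1 → ω q < ω p) :
    IsPeak (chiRank fun _ : Fin n => ε) ω Finset.univ {p} := by
  refine isPeak_singleton (chiRank_injective _) (Finset.mem_univ p) fun j _ hjp _ => ?_
  have := p.2
  have := j.2
  have hne : (j : ℕ) ≠ p := fun h => hjp (Fin.ext h)
  obtain ⟨q, hq, hqj⟩ : ∃ q : Fin n, ((q : ℕ) + 1 = p ∨ (q : ℕ) = p + 1) ∧
      (j ≤ q ∧ q ≤ p ∨ p ≤ q ∧ q ≤ j) := by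
    rcases Nat.lt_or_gt_of_ne hne with h | h
    · let q : Fin n := ⟨p - 1, by omega⟩
      have hq : (q : ℕ) = p - 1 := rfl
      exact ⟨q, by simp only [Fin.le_def]; omega⟩
    · let q : Fin n := ⟨p + 1, by omega⟩
      have hq : (q : ℕ) = p + 1 := rfl
      exact ⟨q, by simp only [Fin.le_def]; omega⟩
  refine ⟨q, Finset.mem_univ q, ?_, hp q hq⟩
  have := q.2
  rw [Set.mem_uIcc]
  simp only [Fin.le_def] at hqj
  cases ε <;> simp only [chiRank] <;> omega

/-! ### Words with two neighbouring entries interchanged -/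

theorem word_add {C : Type*} [Semiring C] {m n : ℕ} (g : Fin (m + n) → C) :
    word g = word (fun i => g (Fin.castAdd n i)) * word (fun i => g (Fin.natAdd m i)) := by
  rw [word, List.ofFn_add, List.prod_append]
  rfl

theorem word_comp_swap {C : Type*} [Semiring C] {n : ℕ} (g : Fin n → C) {p q : Fin n}
    (hpq : (p : ℕ) + 1 = q) (h : g p * g q = g q * g p) :
    word (fun j => g (Equiv.swap p q j)) = word g := by
  obtain ⟨k, hk⟩ : ∃ k : ℕ, (p : ℕ) = k := ⟨_, rfl⟩
  obtain ⟨r, rfl⟩ : ∃ r, n = k + 2 + r := ⟨n - (k + 2), by have := q.2; omega⟩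
  obtain rfl : p = Fin.castAdd r (Fin.natAdd k 0) := Fin.ext (by simpa using hk)
  obtain rfl : q = Fin.castAdd r (Fin.natAdd k 1) := Fin.ext (by simpa using hpq.symm)
  have h2 : ∀ f : Fin 2 → C, word f = f 0 * f 1 := fun f => by simp [word]
  rw [word_add, word_add, word_add g, word_add (fun i => g (Fin.castAdd r i)), h2, h2,
    Equiv.swap_apply_left, Equiv.swap_apply_right, h]
  congr 3
  · funext i
    rw [Equiv.swap_apply_of_ne_of_ne] <;> rw [Ne, Fin.ext_iff] <;> simp <;> omega
  · funext i
    rw [Equiv.swap_apply_of_ne_of_ne] <;> rw [Ne, Fin.ext_iff] <;> simp <;> omega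

/-- Interchanging a left and a right entry which are neighbours does not change the order of the
positions given by `≺_χ`. -/
theorem chiRank_comp_swap_le_iff {n : ℕ} (χ : Fin n → Side) {p q : Fin n} (hpq : (p : ℕ) + 1 = q)
    (hp : χ p = Side.left) (hq : χ q = Side.right) (i j : Fin n) :
    chiRank (fun i => χ (Equiv.swap p q i)) i ≤ chiRank (fun i => χ (Equiv.swap p q i)) j ↔
      chiRank χ (Equiv.swap p q i) ≤ chiRank χ (Equiv.swap p q j) := by
  have hqn := q.2
  have h : ∀ i, (chiRank (fun i => χ (Equiv.swap p q i)) i = 2 * n - p ∧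
        chiRank χ (Equiv.swap p q i) = 2 * n - q) ∨
      (chiRank (fun i => χ (Equiv.swap p q i)) i = q ∧ chiRank χ (Equiv.swap p q i) = p) ∨
      (chiRank (fun i => χ (Equiv.swap p q i)) i = chiRank χ (Equiv.swap p q i) ∧
        chiRank χ (Equiv.swap p q i) ≠ p ∧ chiRank χ (Equiv.swap p q i) ≠ q ∧
        chiRank χ (Equiv.swap p q i) ≠ 2 * n - p ∧ chiRank χ (Equiv.swap p q i) ≠ 2 * n - q) := by
    intro i
    by_cases h1 : i = p
    · left
      rw [h1]
      simp only [chiRank, Equiv.swap_apply_left, hq, and_self]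
    by_cases h2 : i = q
    · right; left
      rw [h2]
      simp only [chiRank, Equiv.swap_apply_right, hp, and_self]
    right; right
    have h1' : (i : ℕ) ≠ p := fun h => h1 (Fin.ext h)
    have h2' : (i : ℕ) ≠ q := fun h => h2 (Fin.ext h)
    have hin := i.2
    have hpn := p.2
    have hσ := Equiv.swap_apply_of_ne_of_ne h1 h2
    have hi : chiRank (fun i => χ (Equiv.swap p q i)) i = chiRank χ i := by
      simp only [chiRank, hσ]
    rw [hi, hσ]
    refine ⟨rfl, ?_⟩
    cases hχ : χ i <;> simp only [chiRank, hχ] <;> refine ⟨?_, ?_, ?_, ?_⟩ <;> omega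
  have hi := h i
  have hj := h j
  omega

/-- Peaks are transported by a permutation that is compatible with the orders. -/
theorem IsPeak.comp_perm {ι κ : Type*} [LinearOrder κ] {ρ ρ' : ι → ℕ} {ω : ι → κ}
    {S V : Finset ι} (σ : Equiv.Perm ι) (hσ : ∀ i j, ρ' i ≤ ρ' j ↔ ρ (σ i) ≤ ρ (σ j))
    (hV : IsPeak ρ ω S V) :
    IsPeak ρ' (fun i => ω (σ i)) (S.map σ.symm.toEmbedding) (V.map σ.symm.toEmbedding) := by
  have hbetween : ∀ i x j, ρ' x ∈ Set.uIcc (ρ' i) (ρ' j) ↔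
      ρ (σ x) ∈ Set.uIcc (ρ (σ i)) (ρ (σ j)) := by
    intro i x j
    simp only [Set.mem_uIcc, hσ]
  have hmem : ∀ (T : Finset ι) j, j ∈ T.map σ.symm.toEmbedding ↔ σ j ∈ T := by
    intro T j
    rw [Finset.mem_map_equiv, Equiv.symm_symm]
  refine ⟨Finset.map_subset_map.2 hV.subset, fun i hi j hj => ?_, fun i hi j hj x hx h => ?_,
    fun i hi j hj hjn hle => ?_⟩
  · rw [hmem] at hi hj
    exact hV.const _ hi _ hj
  · rw [hmem] at hi hj hx ⊢
    exact hV.convex _ hi _ hj _ hx ((hbetween _ _ _).1 h)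
  · rw [hmem] at hi hj hjn
    obtain ⟨x, hx, hxj, hlt⟩ := hV.lower _ hi _ hj hjn hle
    refine ⟨σ.symm x, ?_, ?_, ?_⟩
    · rwa [hmem, Equiv.apply_symm_apply]
    · rwa [hbetween, Equiv.apply_symm_apply]
    · rwa [Equiv.apply_symm_apply]

/-! ### Moments of the faces -/

section FaceWords

variable {K : Type*} {A : Type u} [NonUnitalRing A] [Module ℂ A]
  [IsScalarTower ℂ A A] [SMulCommClass ℂ A A] {B : K → Side → NonUnitalSubalgebra ℂ A}

/-- The products of elements of the faces `B i ε`, the empty product `1` included, in the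
unitization. The factors are recorded together with the faces that contain them. -/
def faceWords (B : K → Side → NonUnitalSubalgebra ℂ A) : Set (Unitization ℂ A) :=
  {z | ∃ l : List (K × Side × A), (∀ t ∈ l, t.2.2 ∈ B t.1 t.2.1) ∧
    (l.map fun t => (Unitization.inr t.2.2 : Unitization ℂ A)).prod = z}

/-- The factors `z` and `w` in the definition of classical independence are linear combinations of
words in the faces. -/
theorem mem_span_faceWords {z : Unitization ℂ A} (hz : z.snd ∈ ⨆ i, ⨆ ε, B i ε) :
    z ∈ Submodule.span ℂ (faceWords B) := by
  let X : Set (Unitization ℂ A) := {x | ∃ i ε, ∃ b ∈ B i ε, Unitization.inr b = x}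
  have hX : Subalgebra.toSubmodule (Algebra.adjoin ℂ X) ≤ Submodule.span ℂ (faceWords B) := by
    rw [Algebra.adjoin_eq_span]
    refine Submodule.span_mono fun x hx => ?_
    induction hx using Submonoid.closure_induction with
    | mem x hx =>
      obtain ⟨i, ε, b, hb, rfl⟩ := hx
      exact ⟨[(i, ε, b)], by simpa using hb, by simp⟩
    | one => exact ⟨[], by simp, by simp⟩
    | mul x y _ _ hx hy =>
      obtain ⟨l, hl, rfl⟩ := hx
      obtain ⟨l', hl', rfl⟩ := hy
      refine ⟨l ++ l', fun t ht => ?_, by simp⟩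
      rcases List.mem_append.1 ht with ht | ht
      · exact hl t ht
      · exact hl' t ht
  have hsup : (⨆ i, ⨆ ε, B i ε) ≤ (Algebra.adjoin ℂ X).toNonUnitalSubalgebra.comap
      (Unitization.inrNonUnitalAlgHom ℂ A) :=
    iSup_le fun i => iSup_le fun ε b hb => Algebra.subset_adjoin ⟨i, ε, b, hb, rfl⟩
  apply hX
  rw [← Unitization.inl_fst_add_inr_snd_eq z]
  exact add_mem (Subalgebra.algebraMap_mem (Algebra.adjoin ℂ X) z.fst) (hsup hz)

theorem word_get {C D : Type*} [Semiring C] (f : D → C) (l : List D) :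
    word (fun i => f (l.get i)) = (l.map f).prod := by
  rw [word]
  congr 1
  exact List.ofFn_getElem_eq_map l f

end FaceWords

section Commutation

variable {K : Type*} [LinearOrder K] {A : Type u} [NonUnitalRing A] [Module ℂ A]
  [IsScalarTower ℂ A A] [SMulCommClass ℂ A A] {φ : A →ₗ[ℂ] ℂ}
  {B : K → Side → NonUnitalSubalgebra ℂ A} {n : ℕ} {χ : Fin n → Side} {ω : Fin n → K}
  {a : Fin n → A}

theorem moment_singleton (φ : A →ₗ[ℂ] ℂ) (a : Fin n → A) (p : Fin n) :
    moment φ a {p} = φ (a p) := by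
  have h : (List.finRange n).filter (fun j => j ∈ ({p} : Finset (Fin n))) = [p] := by
    simp only [Finset.mem_singleton]
    rw [List.filter_eq, List.count_eq_one_of_mem (List.nodup_finRange n) (List.mem_finRange p)]
    rfl
  rw [moment, subword, h]
  simp [unitExt_inr]

/-- A left and a right entry with different indices which are neighbours may be interchanged in
every moment: splitting off blocks with the largest index, both moments become products of
moments of words that do not contain both entries. -/
theorem moment_comp_swap (hB : IsBiMonotonicallyIndependent φ B)
    (ha : ∀ j, a j ∈ B (ω j) (χ j)) {p q : Fin n} (hpq : (p : ℕ) + 1 = q)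
    (hp : χ p = Side.left) (hq : χ q = Side.right) (hω : ω p ≠ ω q) (S : Finset (Fin n)) :
    moment φ (fun j => a (Equiv.swap p q j)) (S.map (Equiv.swap p q).symm.toEmbedding) =
      moment φ a S := by
  have hsmall : ∀ T : Finset (Fin n), ¬ (p ∈ T ∧ q ∈ T) →
      moment φ (fun j => a (Equiv.swap p q j)) (T.map (Equiv.swap p q).symm.toEmbedding) =
        moment φ a T := by
    intro T hT
    rw [moment_eq_unitExt_word, moment_eq_unitExt_word]
    have hmask : mask (fun j => (Unitization.inr (a (Equiv.swap p q j)) : Unitization ℂ A))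
        (T.map (Equiv.swap p q).symm.toEmbedding) =
        fun j => mask (fun j => (Unitization.inr (a j) : Unitization ℂ A)) T
          (Equiv.swap p q j) := by
      funext j
      simp only [mask, Finset.mem_map_equiv, Equiv.symm_symm]
    rw [hmask, word_comp_swap _ hpq]
    by_cases h : p ∈ T
    · rw [mask, mask, if_neg fun h' => hT ⟨h, h'⟩, mul_one, one_mul]
    · rw [mask, if_neg h, mul_one, one_mul]
  induction hN : S.card using Nat.strong_induction_on generalizing S with
  | _ N ih =>
  by_cases hS : p ∈ S ∧ q ∈ S
  swap
  · exact hsmall S hS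
  obtain ⟨i, hi, hmax⟩ := S.exists_max_image ω ⟨p, hS.1⟩
  have hU : IsPeak (chiRank χ) ω S (blockIn (chiRank χ) ω S i) := isPeak_blockIn hmax
  have hiU : i ∈ blockIn (chiRank χ) ω S i := self_mem_blockIn (chiRank_injective χ) hi
  set U := blockIn (chiRank χ) ω S i
  have hU' := hU.comp_perm (Equiv.swap p q) (chiRank_comp_swap_le_iff χ hpq hp hq)
  rw [moment_eq_mul_of_isPeak hB ha hU,
    moment_eq_mul_of_isPeak hB (fun j => ha (Equiv.swap p q j)) hU', ← Finset.map_sdiff,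
    hsmall U fun h => hω (hU.const p h.1 q h.2),
    ih _ (hN ▸ Finset.card_lt_card (Finset.sdiff_ssubset hU.subset ⟨i, hiU⟩)) _ rfl]

theorem map_mul_of_ne (hB : IsBiMonotonicallyIndependent φ B) {k j : K} (hkj : k ≠ j) {b c : A}
    (hb : b ∈ B k Side.left) (hc : c ∈ B j Side.right) : φ (b * c) = φ b * φ c := by
  have ha : ∀ i : Fin 2, ![b, c] i ∈ B (![k, j] i) (![Side.left, Side.right] i) := by
    intro i
    fin_cases i
    · exact hb
    · exact hc
  have huniv : moment φ ![b, c] Finset.univ = φ (b * c) := by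
    rw [moment_eq_unitExt_word, mask_univ]
    simp [word, ← Unitization.inr_mul, unitExt_inr]
  rcases lt_or_gt_of_ne hkj with h | h
  · have hpeak : IsPeak (chiRank ![Side.left, Side.right]) ![k, j] Finset.univ {1} := by
      refine isPeak_singleton (chiRank_injective _) (Finset.mem_univ 1) fun i _ hi hle => ?_
      match i with
      | 0 => exact absurd hle (not_le.2 h)
      | 1 => exact absurd rfl hi
    have := moment_eq_mul_of_isPeak hB ha hpeak
    rw [huniv, show (Finset.univ \ {1} : Finset (Fin 2)) = {0} by decide, moment_singleton,
      moment_singleton] at this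
    exact this.trans (mul_comm _ _)
  · have hpeak : IsPeak (chiRank ![Side.left, Side.right]) ![k, j] Finset.univ {0} := by
      refine isPeak_singleton (chiRank_injective _) (Finset.mem_univ 0) fun i _ hi hle => ?_
      match i with
      | 0 => exact absurd rfl hi
      | 1 => exact absurd hle (not_le.2 h)
    have := moment_eq_mul_of_isPeak hB ha hpeak
    rw [huniv, show (Finset.univ \ {0} : Finset (Fin 2)) = {1} by decide, moment_singleton,
      moment_singleton] at this
    exact this

theorem unitExt_faceWords_comm (hB : IsBiMonotonicallyIndependent φ B) {k j : K} (hkj : k ≠ j)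
    {b c : A} (hb : b ∈ B k Side.left) (hc : c ∈ B j Side.right) {z w : Unitization ℂ A}
    (hz : z ∈ faceWords B) (hw : w ∈ faceWords B) :
    unitExt φ (z * Unitization.inr (b * c) * w) = unitExt φ (z * Unitization.inr (c * b) * w) := by
  obtain ⟨l₁, hl₁, rfl⟩ := hz
  obtain ⟨l₂, hl₂, rfl⟩ := hw
  let s : Fin 2 → K × Side × A := ![(k, Side.left, b), (j, Side.right, c)]
  let t : Fin (l₁.length + 2 + l₂.length) → K × Side × A :=
    Fin.append (Fin.append l₁.get s) l₂.get
  let p : Fin (l₁.length + 2 + l₂.length) := Fin.castAdd _ (Fin.natAdd _ 0)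
  let q : Fin (l₁.length + 2 + l₂.length) := Fin.castAdd _ (Fin.natAdd _ 1)
  have htp : t p = (k, Side.left, b) := by simp [t, p, s]
  have htq : t q = (j, Side.right, c) := by simp [t, q, s]
  have ht : ∀ i, (t i).2.2 ∈ B (t i).1 (t i).2.1 := by
    intro i
    induction i using Fin.addCases with
    | left i =>
      induction i using Fin.addCases with
      | left i => simpa [t] using hl₁ _ (List.getElem_mem i.2)
      | right i =>
        match i with
        | 0 => simpa [t, s] using hb
        | 1 => simpa [t, s] using hc
    | right i => simpa [t] using hl₂ _ (List.getElem_mem i.2)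
  have hpq : (p : ℕ) + 1 = q := by simp [p, q]
  have h := moment_comp_swap hB (φ := φ) ht hpq (by rw [htp]) (by rw [htq])
    (by rw [htp, htq]; exact hkj) Finset.univ
  rw [Finset.map_univ_equiv, moment_eq_unitExt_word, moment_eq_unitExt_word, mask_univ,
    mask_univ] at h
  have h2 : ∀ f : Fin 2 → Unitization ℂ A, word f = f 0 * f 1 := fun f => by simp [word]
  have hword : ∀ t' : Fin (l₁.length + 2 + l₂.length) → K × Side × A,
      (∀ i, i ≠ p → i ≠ q → t' i = t i) →
      word (fun i => (Unitization.inr (t' i).2.2 : Unitization ℂ A)) =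
        (l₁.map fun t => (Unitization.inr t.2.2 : Unitization ℂ A)).prod *
          Unitization.inr ((t' p).2.2 * (t' q).2.2) *
          (l₂.map fun t => (Unitization.inr t.2.2 : Unitization ℂ A)).prod := by
    intro t' ht'
    rw [word_add, word_add (m := l₁.length), h2, Unitization.inr_mul,
      ← word_get _ l₁, ← word_get _ l₂]
    congr 3
    · funext i
      rw [ht' _ (by simp [p, Fin.ext_iff]; omega) (by simp [q, Fin.ext_iff]; omega)]
      simp [t]
    · funext i
      rw [ht' _ (by simp [p, Fin.ext_iff]; omega) (by simp [q, Fin.ext_iff]; omega)]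
      simp [t]
  rw [hword t fun _ _ _ => rfl, hword (fun i => t (Equiv.swap p q i)) fun i h1 h2 => by
    rw [Equiv.swap_apply_of_ne_of_ne h1 h2], Equiv.swap_apply_left, Equiv.swap_apply_right,
    htp, htq] at h
  exact h.symm

theorem isClassicallyIndependent_of_ne (hB : IsBiMonotonicallyIndependent φ B) {k j : K}
    (hkj : k ≠ j) :
    IsClassicallyIndependent φ (⨆ i, ⨆ ε, B i ε) (B k Side.left) (B j Side.right) where
  map_mul _ hb _ hc := map_mul_of_ne hB hkj hb hc
  commute b hb c hc z w hz hw := by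
    have hz' := mem_span_faceWords hz
    have hw' := mem_span_faceWords hw
    clear hz hw
    induction hz' using Submodule.span_induction with
    | zero => simp
    | add x y _ _ hx hy => simp only [add_mul, map_add, hx, hy]
    | smul r x _ hx => simp only [smul_mul_assoc, map_smul, hx]
    | mem z hz =>
      induction hw' using Submodule.span_induction with
      | zero => simp
      | add x y _ _ hx hy => simp only [mul_add, map_add, hx, hy]
      | smul r x _ hx => simp only [mul_smul_comm, map_smul, hx]
      | mem w hw => exact unitExt_faceWords_comm hB hkj hb hc hz hw

theorem isMonotonicallyIndependent_face (hB : IsBiMonotonicallyIndependent φ B) (ε : Side) :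
    IsMonotonicallyIndependent φ fun k => B k ε := by
  intro n ω a ha p hp
  rw [moment_eq_mul_of_isPeak hB ha (isPeak_singleton_of_neighbours ε hp), moment_singleton,
    Finset.sdiff_singleton_eq_erase]

end Commutation

end BiMonotonic

open BiMonotonic
theorem mainTheorem2 {K : Type*} [LinearOrder K]
    {A : Type*} [NonUnitalRing A] [Module ℂ A] [IsScalarTower ℂ A A] [SMulCommClass ℂ A A]
    (φ : A →ₗ[ℂ] ℂ) (B : K → Side → NonUnitalSubalgebra ℂ A)
    (hB : IsBiMonotonicallyIndependent φ B) :
    (∀ (n : ℕ) (χ : Fin n → Side) (ω : Fin n → K) (a : Fin n → A),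
      (∀ j, a j ∈ B (ω j) (χ j)) →
      ∀ (m : ℕ) (V : Fin m → Finset (Fin n)), IsOrderedBlocks χ ω V →
      ∀ k : Fin m,
        (∀ k' : Fin m, (k' : ℕ) + 1 = k ∨ (k' : ℕ) = k + 1 →
          ∀ i ∈ V k, ∀ j ∈ V k', ω j < ω i) →
        moment φ a Finset.univ = moment φ a (V k) * moment φ a (V k)ᶜ) ∧
    IsMonotonicallyIndependent φ (fun k => B k Side.left) ∧
    IsMonotonicallyIndependent φ (fun k => B k Side.right) ∧
    ∀ k j : K, k ≠ j →
      IsClassicallyIndependent φ (⨆ i, ⨆ ε, B i ε) (B k Side.left) (B j Side.right) := by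
  refine ⟨fun n χ ω a ha m V hV k hk => ?_, isMonotonicallyIndependent_face hB Side.left,
    isMonotonicallyIndependent_face hB Side.right,
    fun k j hkj => isClassicallyIndependent_of_ne hB hkj⟩
  rw [moment_eq_mul_of_isPeak hB ha (hV.isPeak k hk), Finset.compl_eq_univ_sdiff]
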